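/- **Setting.** A *logical network* $LN$ is a finite directed graph whose vertices $N$ are subnetworks (sets of machines, each machine lying in exactly one subnetwork). Each arc $N\xrightarrow{F}N'$ carries a firewall $F$, a set of forbidden kinds of communication. A separate vertex $*$ consists of one initially controlled machine. Every other machine $m$ starts uncontrolled, in an unknown configuration. The configurations come from a finite set and are independent across machines, with known distributions. A machine is attacked with scans and exploits, from finite sets of actions and observations. The outcome of an action (the new configuration or control of $m$, and the observation) is determined by the configuration of $m$, and success is observed. An action against $m\in N$ is usable if a machine of $N$ is controlled, or if there is an arc $N'\xrightarrow{F}N$ such that a machine of $N'$ is controlled and $F$ does not forbid the action's communication. An unusable action changes nothing and returns no observation. Every action has a nonpositive reward (duration plus detection risk), and taking control of $m$ yields in addition the value of $m$. The attacker may terminate at any time. $V^*(LN)\in[-\infty,\infty]$ denotes the supremum, over all policies (functions of the past actions and observations), of the expected total undiscounted reward. **Decomposition.** Ignore the directions of the arcs and take the blocks (maximal vertex-biconnected vertex sets with at least two vertices) $B$ of $LN$ that are connected to $*$. The *parent* $N$ of $B$ is the vertex of $B$ through which every path from $*$ to $B$ passes. The associated *component* $C$ is $B\setminus\{N\}$ restricted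 to the vertices reachable from $*$ along directed arcs; empty $C$ are dropped. Clean up $LN$ by keeping only the arcs that lie on a simple directed path starting at $*$. For a real *pivoting reward* $pr(N)$ for each subnetwork $N$, let $V^*(C,pr)$ be the optimal expected total reward of attacking only the machines of $C$ in the cleaned-up network, when the parent of $C$ is controlled and $pr(N)$ is received in addition when a first machine of $N\in C$ comes under control. **Level 1.** Let $C_1,\dots,C_k$ be a topological ordering of the components (parents before children). Start with $pr\equiv 0$. For $i=k,\dots,1$, call a Level-2 procedure, which returns a real number $V(C_i,pr)$, and replace $pr(N)$ by $pr(N)+V(C_i,pr)$ for the parent $N$ of $C_i$. The result is $V(LN):=pr(*)$. **Proposition.** Let $LN$ be a logical network, and let an arbitrary Level-2 procedure and an arbitrary topological ordering of the components be given. 1. If $V(C,pr)=V^*(C,pr)$ for every call to Level 2 made by Level 1 when run on $LN$, then $V(LN)=V^*(LN)$. 2. If $V(C,pr)\le V^*(C,pr)$ for every such call, then $V(LN)\le V^*(LN)$. -/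

import Mathlib

noncomputable section

open scoped Classical

/-! ## POMDPs with deterministic action outcomes -/

/-- A partially observable Markov decision problem in which the outcome of an action (successor
state and observation) is determined by the current state; all the uncertainty is in the initial
belief. `reward s a` is the instantaneous reward `r(s, a, s')` with `s' = next s a`. -/
structure DetPOMDP (S A O : Type*) where
  next : S → A → S
  observe : S → A → O
  reward : S → A → ℝ
  belief : S → ℝ

namespace DetPOMDP

variable {S A O : Type*}

/-- A policy chooses an action from the past actions and observations (most recent first). -/
abbrev Policy (_P : DetPOMDP S A O) : Type _ := List (A × O) → A

/-- The history and the state after `t` steps of policy `π` from state `s`. -/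
def run (P : DetPOMDP S A O) (π : P.Policy) (s : S) : ℕ → List (A × O) × S
  | 0 => ([], s)
  | t + 1 =>
      let h := (P.run π s t).1
      let x := (P.run π s t).2
      ((π h, P.observe x (π h)) :: h, P.next x (π h))

/-- The (undiscounted) reward accumulated by `π` in its first `n` steps from state `s`. -/
def accReward (P : DetPOMDP S A O) (π : P.Policy) (s : S) (n : ℕ) : ℝ :=
  ∑ t ∈ Finset.range n, P.reward (P.run π s t).2 (π (P.run π s t).1)

/-- The expectation, under the initial belief, of the reward accumulated in `n` steps. -/
def expReward [Fintype S] (P : DetPOMDP S A O) (π : P.Policy) (n : ℕ) : ℝ :=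
  ∑ s, P.belief s * P.accReward π s n

/-- The expected total reward of a policy, as an extended real: it is `⊥` for a policy that
accumulates infinite costs. In the attack problems below the expected rewards are eventually
nonincreasing in the number of steps, so that the `limsup` is a limit. -/
def policyValue [Fintype S] (P : DetPOMDP S A O) (π : P.Policy) : EReal :=
  Filter.limsup (fun n : ℕ => ((P.expReward π n : ℝ) : EReal)) Filter.atTop

/-- The optimal expected total reward `V*`. -/
def optValue [Fintype S] (P : DetPOMDP S A O) : EReal := ⨆ π : P.Policy, P.policyValue π

end DetPOMDP

/-! ## Logical networks and attacks on them -/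

/-- A logical network: a directed graph on the set `V` of subnetworks, each arc carrying a
firewall, together with the machines and the models of the actions (scans and exploits) against
each single machine.

`Config` holds the possible configurations of a machine that is not under control (installed
programs, vulnerabilities, open ports, crashed or not, ...), `Port` the kinds of communication. -/
structure LogicalNetwork (V M Config Act Obs Port : Type*) where
  /-- The subnetwork `*` of the machine from which the attack starts. -/
  root : V
  /-- `arc N N'`: the subnetwork `N` is connected to the subnetwork `N'`. -/
  arc : V → V → Prop
  /-- The firewall on the arc from `N` to `N'`: the set of communications that it forbids. -/
  firewall : V → V → Set Port
  /-- The subnetwork of each machine. -/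
  subnet : M → V
  /-- `*` is a separate vertex: it contains no machine but the one controlled initially. -/
  subnet_ne_root : ∀ m, subnet m ≠ root
  /-- The communication used by an action against machine `m`. -/
  port : M → Act → Port
  /-- The effect of an action against machine `m` in a given configuration: `none` means that `m`
  comes under control, `some c'` that its configuration becomes `c'`. -/
  outcome : M → Act → Config → Option Config
  /-- The observation made when the action does not bring `m` under control. -/
  observation : M → Act → Config → Obs
  /-- The reward for taking control of a machine. -/
  value : M → ℝ
  /-- The reward reflecting the duration of an action. -/
  timeReward : M → Act → ℝ
  timeReward_nonpos : ∀ m a, timeReward m a ≤ 0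
  /-- The reward reflecting the risk of detection of an action. -/
  riskReward : M → Act → ℝ
  riskReward_nonpos : ∀ m a, riskReward m a ≤ 0
  /-- The initial belief on the configuration of each machine; the configurations of distinct
  machines are independent. -/
  belief : M → Config → ℝ
  belief_nonneg : ∀ m c, 0 ≤ belief m c
  belief_sum : ∀ m, ∑ᶠ c, belief m c = 1

/-- What the attacker observes after an action: nothing, if the action could not be used; that the
exploit succeeded; or the result of a scan or of a failed exploit. -/
inductive Response (Obs : Type*) where
  | nothing : Response Obs
  | succeeded : Response Obs
  | result : Obs → Response Obs

namespace LogicalNetwork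

variable {V M Config Act Obs Port : Type*} (LN : LogicalNetwork V M Config Act Obs Port)

/-- The machines in a set of subnetworks. -/
abbrev Machines (C : Set V) : Type _ := {m : M // LN.subnet m ∈ C}

/-- A joint state of the machines in `C`: each is controlled (`none`) or in some configuration. -/
abbrev AttackState (C : Set V) : Type _ := LN.Machines C → Option Config

/-- The subnetwork `N` is under control: it is the initially controlled `src`, or one of its
machines is controlled. -/
def Controlled (src : V) (C : Set V) (s : LN.AttackState C) (N : V) : Prop :=
  N = src ∨ ∃ m : LN.Machines C, LN.subnet m = N ∧ s m = none

/-- Action `a` can be used against machine `m`: `m` is in a subnetwork under control (then there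
is no firewall in between), or it is reached from a subnetwork under control through an arc of
the relation `E` whose firewall does not filter the action. -/
def Usable (E : V → V → Prop) (src : V) (C : Set V) (s : LN.AttackState C)
    (m : LN.Machines C) (a : Act) : Prop :=
  LN.Controlled src C s (LN.subnet m) ∨
    ∃ N, LN.Controlled src C s N ∧ E N (LN.subnet m) ∧
      LN.port m a ∉ LN.firewall N (LN.subnet m)

/-- The state after action `a` against machine `m`. -/
def nextState (E : V → V → Prop) (src : V) (C : Set V) (s : LN.AttackState C)
    (m : LN.Machines C) (a : Act) : LN.AttackState C :=
  match s m with
  | none => s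
  | some c =>
      if LN.Usable E src C s m a then Function.update s m (LN.outcome m a c) else s

/-- The observation made when action `a` is used against machine `m`. -/
def response (E : V → V → Prop) (src : V) (C : Set V) (s : LN.AttackState C)
    (m : LN.Machines C) (a : Act) : Response Obs :=
  match s m with
  | none => Response.nothing
  | some c =>
      if LN.Usable E src C s m a then
        (if LN.outcome m a c = none then Response.succeeded
          else Response.result (LN.observation m a c))
      else Response.nothing

/-- The reward of action `a` against machine `m`: its costs and, if the action takes control of
`m`, the value of `m` and, if `m` is the first machine of its subnetwork that comes under control,
the pivoting reward of that subnetwork. -/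
def stepReward (E : V → V → Prop) (src : V) (C : Set V) (pr : V → ℝ) (s : LN.AttackState C)
    (m : LN.Machines C) (a : Act) : ℝ :=
  LN.timeReward m a + LN.riskReward m a +
    (if s m ≠ none ∧ LN.nextState E src C s m a m = none then
      LN.value m + (if LN.Controlled src C s (LN.subnet m) then 0 else pr (LN.subnet m))
    else 0)

/-- The initial belief: no machine of `C` is controlled, and their configurations are
independent. -/
def initialBelief (C : Set V) [Fintype M] (s : LN.AttackState C) : ℝ :=
  ∏ m : LN.Machines C, (match s m with
    | none => 0
    | some c => LN.belief m c)

/-- The problem of attacking the set `C` of subnetworks, along the arcs of the relation `E`, from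
a controlled subnetwork `src`, with pivoting rewards `pr`. The state `none` is the terminal state
and the action `none` is to terminate the attack. -/
def attack [Fintype M] (E : V → V → Prop) (src : V) (C : Set V) (pr : V → ℝ) :
    DetPOMDP (Option (LN.AttackState C)) (Option (LN.Machines C × Act)) (Response Obs) where
  next
    | some s, some (m, a) => some (LN.nextState E src C s m a)
    | _, _ => none
  observe
    | some s, some (m, a) => LN.response E src C s m a
    | _, _ => Response.nothing
  reward
    | some s, some (m, a) => LN.stepReward E src C pr s m a
    | _, _ => 0
  belief
    | some s => LN.initialBelief C s
    | none => 0

/-- `V*(LN)`: the optimal expected reward of attacking the whole network from `*`. -/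
def optimalValue [Fintype M] [Fintype Config] : EReal :=
  (LN.attack LN.arc LN.root Set.univ 0).optValue

/-! ## The decomposition into biconnected components -/

/-- A set of at least two vertices is biconnected if it induces a connected graph, and still does
when any one of its vertices is removed. -/
def IsBiconnected (G : SimpleGraph V) (B : Set V) : Prop :=
  B.Nontrivial ∧ (G.induce B).Connected ∧ ∀ v ∈ B, (G.induce (B \ {v})).Connected

/-- The network with the directions of the arcs ignored. -/
def undirected : SimpleGraph V := SimpleGraph.fromRel LN.arc

/-- A block of the undirected network: a maximal biconnected set of vertices. -/
def IsBlock (B : Set V) : Prop := Maximal (IsBiconnected LN.undirected) B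

/-- `p` is the vertex of `B` through which `*` is connected to `B`. -/
def IsParent (p : V) (B : Set V) : Prop :=
  p ∈ B ∧ LN.undirected.Reachable LN.root p ∧
    ∀ v ∈ B, ∀ w : LN.undirected.Walk LN.root v, p ∈ w.support

/-- A set of subnetworks with its parent vertex. -/
structure Component (V : Type*) where
  nodes : Set V
  parent : V

/-- The (non-root) components of the cleaned-up tree rooted at `*`: from each block, the cut vertex
closest to `*` is removed, as it belongs to the component closer to `*` (or is `*` itself), and so
are the vertices that cannot be reached from `*` along directed arcs. -/
def IsComponent (C : Component V) : Prop :=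
  C.nodes.Nonempty ∧ ∃ B, LN.IsBlock B ∧ LN.IsParent C.parent B ∧
    C.nodes = {v | v ∈ B ∧ v ≠ C.parent ∧ Relation.ReflTransGen LN.arc LN.root v}

/-- The arcs kept by the clean-up: those on some simple directed path that starts at `*`. -/
def cleanArc (N N' : V) : Prop :=
  ∃ l : List V, l.Nodup ∧ l.head? = some LN.root ∧ l.IsChain LN.arc ∧ [N, N'] <:+: l

/-- `l` lists the components in a topological order of the tree: a component never comes after one
of its children. -/
def IsTopologicalOrder (l : List (Component V)) : Prop :=
  l.Nodup ∧ (∀ C, C ∈ l ↔ LN.IsComponent C) ∧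
    l.Pairwise (fun C C' => C.parent ∉ C'.nodes)

/-- `V*(C, pr)`: the optimal expected reward of attacking the component `C` in the cleaned-up
network, given that its parent is controlled and that its pivoting rewards are `pr`. -/
def componentValue [Fintype M] [Fintype Config] (C : Component V) (pr : V → ℝ) : EReal :=
  (LN.attack LN.cleanArc C.parent C.nodes pr).optValue

/-! ## The algorithm: Level 1 -/

/-- The loop of Level 1, over the list of components still to be treated, from the current
pivoting rewards: run the Level-2 procedure `L2` on the next component and add the result to the
pivoting reward of its parent. -/
def level1Loop (L2 : Component V → (V → ℝ) → ℝ) : List (Component V) → (V → ℝ) → (V → ℝ)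
  | [], pr => pr
  | C :: l, pr => level1Loop L2 l (Function.update pr C.parent (pr C.parent + L2 C pr))

/-- The arguments of the calls to Level 2 made by that loop. -/
def loopCalls (L2 : Component V → (V → ℝ) → ℝ) :
    List (Component V) → (V → ℝ) → List (Component V × (V → ℝ))
  | [], _ => []
  | C :: l, pr =>
      (C, pr) :: loopCalls L2 l (Function.update pr C.parent (pr C.parent + L2 C pr))

/-- `V(LN)`: the result of Level 1. The components `C₁, …, Cₖ`, listed in a topological order, are
treated in reverse, starting from the pivoting reward `0`; the result is the final pivoting reward
of `*`. -/
def level1 (L2 : Component V → (V → ℝ) → ℝ) (order : List (Component V)) : ℝ :=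
  level1Loop L2 order.reverse 0 LN.root

/-- The arguments of the calls to Level 2 made by Level 1. -/
def level2Calls (L2 : Component V → (V → ℝ) → ℝ) (order : List (Component V)) :
    List (Component V × (V → ℝ)) :=
  loopCalls L2 order.reverse 0

end LogicalNetwork

end

/-!
All uncertainty lies in the initial configurations, and the outcome of an action depends on the
attacked machine alone. Two reductions carry the argument.

*Finite plans.* Terminating costs nothing, so the first `n` steps of a policy are as good as a
decision tree of finite depth, and a tree is as good as a policy. Hence every optimal value is the
supremum of the expected rewards of finite trees (`optValue_attack`), and statements about values
can be proved by induction on trees.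

*Splitting off a leaf.* Let the subnetworks `W` consist of `U` and of a leaf component `C` with
parent `p` (`IsLeaf`), and let `v = V*(C, pr)`. Then attacking `W` is worth as much as attacking `U`
with `v` added to the pivoting reward of `p` (`IsLeaf.rootedValue_le`, `IsLeaf.le_rootedValue`;
if `p = *`, the amount `v` is received at the start). For `≥`, a nearly optimal tree for `C` is
grafted onto a tree for `U` where `p` comes under control. For `≤`, a tree for `W` is taken apart.
For a fixed state of `C` it contains a tree against `U`, for a fixed state of `U` one against `C`.
While `p` is not under control, actions against `C` do nothing and the configurations in `C` keep
their initial, independent distribution; from then on the rewards of the two trees add up, and the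
tree against `C` is worth at most `v`. This uses that the controlled subnetworks are always linked
to `*` by controlled paths (`Spread`), so that the arcs removed by the clean-up are useless
(`Spread.cleanArc`) and `C` cannot be entered before `p` is controlled.

The graph theory needed is that each arc kept by the clean-up leads from a component or its parent
into that component (`exists_isComponent_of_cleanArc`) and that components are disjoint
(`IsComponent.eq_of_mem`). The first rests on the existence of the parent of a block, where adding
an ear to a biconnected set leaves it biconnected (`IsBiconnected.union_path`), the second on the
fact that two biconnected sets with two common vertices have a biconnected union.

In the reverse of a topological order each component is a leaf of what remains, so the loop of
Level 1 splits the network off component by component. Subnetworks outside all components cannot be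
reached and form one more leaf, of value `0`. Both directions of the leaf lemma need only one
inequality between `v` and `V*(C, pr)`, which gives the two parts of the proposition.
-/

noncomputable section

open scoped Classical

/-! ### Finite decision trees -/

/-- A finite-depth attack plan: halt, or take an action and continue according to the
observation. -/
inductive DecisionTree (A O : Type*) where
  | halt : DecisionTree A O
  | act : A → (O → DecisionTree A O) → DecisionTree A O

namespace DecisionTree

variable {S A A' O : Type*}

/-- The total reward of carrying out the plan from a given state, for deterministic dynamics. -/
def gain (next : S → A → S) (obs : S → A → O) (rew : S → A → ℝ) : DecisionTree A O → S → ℝ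
  | halt, _ => 0
  | act a k, s => rew s a + gain next obs rew (k (obs s a)) (next s a)

/-- Relabel the actions of a plan. -/
def mapAct (f : A → A') : DecisionTree A O → DecisionTree A' O
  | halt => halt
  | act a k => act (f a) fun o => mapAct f (k o)

/-- Carry out one plan and, when it stops, another one. -/
def seq : DecisionTree A O → DecisionTree A O → DecisionTree A O
  | halt, T => T
  | act a k, T => act a fun o => seq (k o) T

/-- What remains of a plan after a history (most recent step first). -/
def follow (T : DecisionTree A O) : List (A × O) → DecisionTree A O
  | [] => T
  | (_, o) :: h =>
    match follow T h with
    | halt => halt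
    | act _ k => k o

/-- The policy that carries out the plan and then takes the action `a₀` for ever. -/
def toPolicy (T : DecisionTree A O) (a₀ : A) (h : List (A × O)) : A :=
  match T.follow h with
  | halt => a₀
  | act a _ => a

/-- The plan given by the next `n` steps of a policy after history `h`. -/
def ofPolicy (π : List (A × O) → A) : ℕ → List (A × O) → DecisionTree A O
  | 0, _ => halt
  | n + 1, h => act (π h) fun o => ofPolicy π n ((π h, o) :: h)

/-- Replace the action `none` by stopping. -/
def cutNone : DecisionTree (Option A) O → DecisionTree A O
  | halt => halt
  | act none _ => halt
  | act (some a) k => act a fun o => cutNone (k o)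

end DecisionTree

namespace DetPOMDP

variable {S A O : Type*} (P : DetPOMDP S A O)

/-- The total reward of a plan from a given state. -/
abbrev treeGain (T : DecisionTree A O) (s : S) : ℝ := T.gain P.next P.observe P.reward s

lemma accReward_succ (π : P.Policy) (s : S) (n : ℕ) :
    P.accReward π s (n + 1) =
      P.accReward π s n + P.reward (P.run π s n).2 (π (P.run π s n).1) :=
  Finset.sum_range_succ _ _

lemma treeGain_ofPolicy (π : P.Policy) (s : S) (n k : ℕ) :
    P.accReward π s k + P.treeGain (.ofPolicy π n (P.run π s k).1) (P.run π s k).2 =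
      P.accReward π s (k + n) := by
  induction n generalizing k with
  | zero => simp [DecisionTree.ofPolicy, treeGain, DecisionTree.gain]
  | succ n ih =>
    have h := ih (k + 1)
    rw [accReward_succ] at h
    rw [show k + (n + 1) = k + 1 + n by ring, ← h]
    simp [DecisionTree.ofPolicy, treeGain, DecisionTree.gain, run, add_assoc]

lemma treeGain_toPolicy (T : DecisionTree A O) (a₀ : A) (h₀ : ∀ s, P.reward s a₀ = 0) (s : S)
    (n : ℕ) :
    P.accReward (T.toPolicy a₀) s n +
      P.treeGain (T.follow (P.run (T.toPolicy a₀) s n).1) (P.run (T.toPolicy a₀) s n).2 =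
      P.treeGain T s := by
  induction n with
  | zero => simp [accReward, run, DecisionTree.follow]
  | succ n ih =>
    rw [accReward_succ, ← ih, add_assoc]
    congr 1
    generalize hh : (P.run (T.toPolicy a₀) s n) = q
    cases hT : T.follow q.1 <;>
      simp [run, hh, DecisionTree.follow, DecisionTree.toPolicy, hT, treeGain,
        DecisionTree.gain, h₀]

lemma eventually_follow_eq_halt (T : DecisionTree A O) (a₀ : A) (s : S) :
    ∀ᶠ n in Filter.atTop, T.follow (P.run (T.toPolicy a₀) s n).1 = .halt := by
  have succ_step : ∀ n, T.follow (P.run (T.toPolicy a₀) s (n + 1)).1 =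
      match T.follow (P.run (T.toPolicy a₀) s n).1 with
      | .halt => .halt
      | .act a k => k (P.observe (P.run (T.toPolicy a₀) s n).2 a) := by
    intro n
    generalize hh : (P.run (T.toPolicy a₀) s n) = q
    cases hT : T.follow q.1 <;> simp [run, hh, DecisionTree.follow, DecisionTree.toPolicy, hT]
  have key : ∀ T' : DecisionTree A O, ∀ n, T.follow (P.run (T.toPolicy a₀) s n).1 = T' →
      ∃ m, T.follow (P.run (T.toPolicy a₀) s m).1 = .halt := by
    intro T'
    induction T' with
    | halt => exact fun n h => ⟨n, h⟩
    | act a k ih =>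
      intro n h
      refine ih (P.observe (P.run (T.toPolicy a₀) s n).2 a) (n + 1) ?_
      rw [succ_step, h]
  obtain ⟨m, hm⟩ := key _ 0 rfl
  filter_upwards [Filter.eventually_ge_atTop m] with n hn
  induction n, hn using Nat.le_induction with
  | base => exact hm
  | succ n _ ih => rw [succ_step, ih]

/-- If some action is free of reward in every state, infinite horizons bring nothing beyond finite
plans: the first `n` steps of a policy form a plan, and a plan is a policy that ends with the free
action. -/
lemma optValue_eq_iSup_treeGain [Fintype S] (a₀ : A) (h₀ : ∀ s, P.reward s a₀ = 0) :
    P.optValue = ⨆ T : DecisionTree A O, ((∑ s, P.belief s * P.treeGain T s : ℝ) : EReal) := by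
  apply le_antisymm
  · refine iSup_le fun π => ?_
    refine Filter.limsup_le_of_le (h := Filter.Eventually.of_forall fun n => ?_)
    refine le_trans (le_of_eq ?_) (le_iSup _ (DecisionTree.ofPolicy π n []))
    congr 1
    refine Finset.sum_congr rfl fun s _ => ?_
    have := P.treeGain_ofPolicy π s n 0
    simp only [accReward, Finset.range_zero, Finset.sum_empty, zero_add, run] at this ⊢
    rw [← this]
  · refine iSup_le fun T => ?_
    refine le_trans (le_of_eq ?_) (le_iSup _ (T.toPolicy a₀ : P.Policy))
    have hev : ∀ᶠ n in Filter.atTop, ∀ s,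
        T.follow (P.run (T.toPolicy a₀) s n).1 = .halt :=
      Filter.eventually_all.2 fun s => P.eventually_follow_eq_halt T a₀ s
    have hlim : (fun n : ℕ => ((P.expReward (T.toPolicy a₀) n : ℝ) : EReal)) =ᶠ[Filter.atTop]
        fun _ => ((∑ s, P.belief s * P.treeGain T s : ℝ) : EReal) := by
      filter_upwards [hev] with n hn
      congr 1
      refine Finset.sum_congr rfl fun s _ => ?_
      rw [← P.treeGain_toPolicy T a₀ h₀ s n, hn s]
      simp [treeGain, DecisionTree.gain]
    rw [policyValue, Filter.limsup_congr hlim, Filter.limsup_const]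

end DetPOMDP

namespace LogicalNetwork

variable {V M Config Act Obs Port : Type*} (LN : LogicalNetwork V M Config Act Obs Port)

/-- The plans for attacking the machines in `C`. -/
abbrev Plan (C : Set V) : Type _ := DecisionTree (LN.Machines C × Act) (Response Obs)

/-- The total reward of a plan, from a given state of the machines in `C`. -/
def gain (E : V → V → Prop) (src : V) (C : Set V) (pr : V → ℝ) (T : LN.Plan C)
    (s : LN.AttackState C) : ℝ :=
  DecisionTree.gain (fun s q => LN.nextState E src C s q.1 q.2)
    (fun s q => LN.response E src C s q.1 q.2)
    (fun s q => LN.stepReward E src C pr s q.1 q.2) T s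

@[simp] lemma gain_halt (E : V → V → Prop) (src : V) (C : Set V) (pr : V → ℝ)
    (s : LN.AttackState C) : LN.gain E src C pr .halt s = 0 := rfl

lemma gain_act (E : V → V → Prop) (src : V) (C : Set V) (pr : V → ℝ)
    (m : LN.Machines C) (a : Act) (k : Response Obs → LN.Plan C) (s : LN.AttackState C) :
    LN.gain E src C pr (.act (m, a) k) s = LN.stepReward E src C pr s m a +
      LN.gain E src C pr (k (LN.response E src C s m a)) (LN.nextState E src C s m a) := rfl

/-- The expected total reward of a plan. -/
def expGain [Fintype M] [Fintype Config] (E : V → V → Prop) (src : V) (C : Set V) (pr : V → ℝ)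
    (T : LN.Plan C) : ℝ :=
  ∑ s, LN.initialBelief C s * LN.gain E src C pr T s

lemma treeGain_attack_none [Fintype M] (E : V → V → Prop) (src : V) (C : Set V) (pr : V → ℝ)
    (T : DecisionTree (Option (LN.Machines C × Act)) (Response Obs)) :
    (LN.attack E src C pr).treeGain T none = 0 := by
  induction T with
  | halt => rfl
  | act a k ih =>
    simpa [DetPOMDP.treeGain, DecisionTree.gain, attack] using ih _

lemma treeGain_attack_some [Fintype M] (E : V → V → Prop) (src : V) (C : Set V) (pr : V → ℝ)
    (T : DecisionTree (Option (LN.Machines C × Act)) (Response Obs)) (s : LN.AttackState C) :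
    (LN.attack E src C pr).treeGain T (some s) = LN.gain E src C pr T.cutNone s := by
  induction T generalizing s with
  | halt => rfl
  | act a k ih =>
    cases a with
    | none =>
      have := LN.treeGain_attack_none E src C pr (k Response.nothing)
      simpa [DetPOMDP.treeGain, DecisionTree.gain, attack, DecisionTree.cutNone] using this
    | some q => exact congrArg (_ + ·) (ih _ _)

lemma cutNone_mapAct_some {A O : Type*} (T : DecisionTree A O) :
    (T.mapAct some).cutNone = T := by
  induction T with
  | halt => rfl
  | act a k ih => simp [DecisionTree.mapAct, DecisionTree.cutNone, ih]

/-- The optimal value of an attack is the supremum of the expected rewards of finite plans. -/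
lemma optValue_attack [Fintype M] [Fintype Config] (E : V → V → Prop) (src : V) (C : Set V)
    (pr : V → ℝ) :
    (LN.attack E src C pr).optValue =
      ⨆ T : LN.Plan C, ((LN.expGain E src C pr T : ℝ) : EReal) := by
  have h : ∀ T, ∑ s, (LN.attack E src C pr).belief s * (LN.attack E src C pr).treeGain T s =
      LN.expGain E src C pr T.cutNone := by
    intro T
    rw [Fintype.sum_option]
    simp only [treeGain_attack_none, treeGain_attack_some, mul_zero, zero_add]
    rfl
  rw [DetPOMDP.optValue_eq_iSup_treeGain _ none]
  · simp only [h]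
    refine Function.Surjective.iSup_comp
      (g := fun T : LN.Plan C => ((LN.expGain E src C pr T : ℝ) : EReal)) ?_
    exact fun T => ⟨T.mapAct some, cutNone_mapAct_some T⟩
  · rintro (_ | s) <;> rfl

end LogicalNetwork

/-! ### Simple directed paths -/

section Chains

variable {α : Type*} {r : α → α → Prop}

lemma exists_nodup_isChain_of_reflTransGen {a b : α} (h : Relation.ReflTransGen r a b) :
    ∃ l : List α, (l ++ [b]).Nodup ∧ (l ++ [b]).head? = some a ∧ (l ++ [b]).IsChain r := by
  induction h with
  | refl => exact ⟨[], by simp, by simp, by simp⟩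
  | @tail b c _ hbc ih =>
    obtain ⟨l, hn, hh, hc⟩ := ih
    by_cases hmem : c ∈ l ++ [b]
    · obtain ⟨s, t, hst⟩ := List.append_of_mem hmem
      rw [hst, show s ++ c :: t = (s ++ [c]) ++ t by simp] at hn hh hc
      refine ⟨s, hn.of_append_left, ?_, hc.left_of_append⟩
      cases s <;> simpa using hh
    · refine ⟨l ++ [b], ?_, ?_, ?_⟩
      · rw [List.nodup_append]
        refine ⟨hn, by simp, ?_⟩
        rintro x hx y hy rfl
        rw [List.mem_singleton.1 hy] at hx
        exact hmem hx
      · rw [List.head?_append, hh]; rfl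
      · rw [List.isChain_append]
        refine ⟨hc, by simp, ?_⟩
        simpa using hbc

lemma reflTransGen_of_isChain {a c : α} {l : List α} (h : (a :: l).IsChain r) (hc : c ∈ a :: l) :
    Relation.ReflTransGen (fun x y => r x y ∧ y ∈ l) a c := by
  induction l generalizing a with
  | nil => rw [List.mem_singleton.1 hc]
  | cons b l ih =>
    rcases List.mem_cons.1 hc with rfl | hc
    · exact .refl
    · rw [List.isChain_cons_cons] at h
      refine .head ⟨h.1, by simp⟩ (Relation.ReflTransGen.mono ?_ _ _ (ih h.2 hc))
      exact fun x y hxy => ⟨hxy.1, List.mem_cons_of_mem _ hxy.2⟩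

end Chains

/-! ### Biconnected sets -/

namespace LogicalNetwork

section Biconnected

variable {V : Type*} {G : SimpleGraph V}

lemma isBiconnected_pair {u v : V} (h : G.Adj u v) : IsBiconnected G {u, v} := by
  refine ⟨Set.nontrivial_pair h.ne, G.induce_pair_connected_of_adj h, ?_⟩
  rintro w (rfl | rfl)
  · rw [Set.pair_sdiff_left h.ne]
    exact (SimpleGraph.connected_iff_exists_forall_reachable _).2
      ⟨⟨v, rfl⟩, fun ⟨x, hx⟩ => by obtain rfl : x = v := hx; rfl⟩
  · rw [Set.pair_sdiff_right h.ne]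
    exact (SimpleGraph.connected_iff_exists_forall_reachable _).2
      ⟨⟨u, rfl⟩, fun ⟨x, hx⟩ => by obtain rfl : x = u := hx; rfl⟩

lemma IsBiconnected.connected_diff {B : Set V} (hB : IsBiconnected G B) (w : V) :
    (G.induce (B \ {w})).Connected := by
  by_cases hw : w ∈ B
  · exact hB.2.2 w hw
  · rw [Set.sdiff_singleton_eq_self hw]; exact hB.2.1

lemma IsBiconnected.union {B B' : Set V} (hB : IsBiconnected G B) (hB' : IsBiconnected G B')
    {p q : V} (hpq : p ≠ q) (hp : p ∈ B) (hp' : p ∈ B') (hq : q ∈ B) (hq' : q ∈ B') :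
    IsBiconnected G (B ∪ B') := by
  refine ⟨hB.1.mono Set.subset_union_left, SimpleGraph.induce_union_connected
    hB.2.1.preconnected hB'.2.1.preconnected ⟨p, hp, hp'⟩, fun w _ => ?_⟩
  rw [Set.union_sdiff_distrib]
  refine SimpleGraph.induce_union_connected (hB.connected_diff w).preconnected
    (hB'.connected_diff w).preconnected ?_
  by_cases hw : p = w
  · exact ⟨q, ⟨hq, fun h => hpq (hw.trans (Eq.symm h))⟩, ⟨hq', fun h => hpq (hw.trans (Eq.symm h))⟩⟩
  · exact ⟨p, ⟨hp, hw⟩, ⟨hp', hw⟩⟩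

/-- A biconnected set stays biconnected when an ear is added: if a vertex `w` of the ear is
removed, every other vertex of the ear is still linked to an end of the ear on its own side
of `w`. -/
lemma IsBiconnected.union_path {B : Set V} (hB : IsBiconnected G B) {p q : V} (hp : p ∈ B)
    (hq : q ∈ B) {R : G.Walk p q} (hR : R.IsPath) :
    IsBiconnected G (B ∪ {x | x ∈ R.support}) := by
  refine ⟨hB.1.mono Set.subset_union_left, SimpleGraph.induce_union_connected
    hB.2.1.preconnected R.connected_induce_support.preconnected ⟨p, hp, R.start_mem_support⟩,
    fun w _ => ?_⟩
  obtain ⟨⟨u, hu⟩⟩ := (hB.connected_diff w).nonempty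
  refine SimpleGraph.induce_connected_of_patches u ⟨Or.inl hu.1, hu.2⟩ ?_
  -- a walk inside `B ∪ R` that avoids `w` and meets `B` links its vertices to `B \ {w}`
  have patch : ∀ {c d x : V} (Q : G.Walk c d), (∀ y ∈ Q.support, y ∈ R.support) →
      w ∉ Q.support → (c ∈ B ∨ d ∈ B) → x ∈ Q.support →
      ∃ s' ⊆ (B ∪ {x | x ∈ R.support}) \ {w}, ∃ (hu' : u ∈ s') (hv' : x ∈ s'),
        (G.induce s').Reachable ⟨u, hu'⟩ ⟨x, hv'⟩ := by
    intro c d x Q hQ hw hcd hx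
    have hQw : ∀ y ∈ Q.support, y ≠ w := fun y hy h => hw (h ▸ hy)
    have hconn := SimpleGraph.induce_union_connected (hB.connected_diff w).preconnected
      Q.connected_induce_support.preconnected (by
        rcases hcd with h | h
        · exact ⟨c, ⟨h, hQw c Q.start_mem_support⟩, Q.start_mem_support⟩
        · exact ⟨d, ⟨h, hQw d Q.end_mem_support⟩, Q.end_mem_support⟩)
    refine ⟨_, ?_, Or.inl hu, Or.inr hx, hconn.preconnected _ _⟩
    rintro y (hy | hy)
    · exact ⟨Or.inl hy.1, hy.2⟩
    · exact ⟨Or.inr (hQ y hy), hQw y hy⟩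
  rintro x ⟨hx | hx, hxw⟩
  · exact ⟨_, Set.sdiff_subset_sdiff_left Set.subset_union_left, hu, ⟨hx, hxw⟩,
      (hB.connected_diff w).preconnected _ _⟩
  · have hx : x ∈ R.support := hx
    by_cases h : w ∈ (R.takeUntil x hx).support
    · refine patch (R.dropUntil x hx) (fun y hy => R.support_dropUntil_subset_support hx hy) ?_
        (Or.inr hq) (SimpleGraph.Walk.start_mem_support _)
      intro h'
      have hnd := hR.support_nodup
      rw [← R.take_spec hx, SimpleGraph.Walk.support_append, List.nodup_append] at hnd
      rw [SimpleGraph.Walk.mem_support_iff] at h'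
      rcases h' with h' | h'
      · exact hxw h'.symm
      · exact hnd.2.2 w h w h' rfl
    · exact patch (R.takeUntil x hx) (fun y hy => R.support_takeUntil_subset_support hx hy) h
        (Or.inl hp) (SimpleGraph.Walk.end_mem_support _)

end Biconnected

variable {V M Config Act Obs Port : Type*} (LN : LogicalNetwork V M Config Act Obs Port)

/-! ### Blocks, parents and components -/

lemma undirected_adj {u v : V} (hne : u ≠ v) (h : LN.arc u v) : LN.undirected.Adj u v :=
  (SimpleGraph.fromRel_adj _ _ _).2 ⟨hne, Or.inl h⟩

lemma exists_isBlock [Finite V] {u v : V} (h : LN.undirected.Adj u v) :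
    ∃ B, LN.IsBlock B ∧ u ∈ B ∧ v ∈ B := by
  obtain ⟨B, hB, hmax⟩ := (Set.toFinite {B : Set V | IsBiconnected LN.undirected B}).exists_le_maximal
    (isBiconnected_pair h)
  exact ⟨B, hmax, hB (by simp), hB (by simp)⟩

/-- A block that is connected to `*` has a parent, its vertex closest to `*`. A walk from `*` that
entered the block elsewhere would close an ear, against maximality. -/
lemma IsBlock.exists_isParent {B : Set V} (hB : LN.IsBlock B) {v : V} (hv : v ∈ B)
    (hr : LN.undirected.Reachable LN.root v) : ∃ p, LN.IsParent p B := by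
  -- a walk from `*` that avoids `Q` and meets the block can be cut off where it first does so
  have first_hit : ∀ Q : Set V, (∀ v (w : LN.undirected.Walk LN.root v), v ∈ B →
      (∀ x ∈ w.support, x ∉ Q) → ∃ p, p ∈ B ∧ ∃ w : LN.undirected.Walk LN.root p,
        (∀ x ∈ w.support, x ∉ Q) ∧ ∀ x ∈ w.support, x ∈ B → x = p) := by
    intro Q v w
    induction hn : w.length using Nat.strong_induction_on generalizing v with
    | _ n ih =>
      intro hv hQ
      by_cases hx : ∀ x ∈ w.support, x ∈ B → x = v
      · exact ⟨v, hv, w, hQ, hx⟩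
      · push Not at hx
        obtain ⟨x, hxs, hxB, hxv⟩ := hx
        refine ih _ ?_ x (w.takeUntil x hxs) rfl hxB fun y hy =>
          hQ y (w.support_takeUntil_subset_support hxs hy)
        exact hn ▸ w.length_takeUntil_lt_length hxs hxv
  obtain ⟨p, hpB, P, -, hP⟩ := first_hit ∅ v hr.some hv (by simp)
  refine ⟨p, hpB, ⟨P⟩, fun v hv w => ?_⟩
  by_contra hpw
  obtain ⟨q, hqB, Q, hQp, hQ⟩ := first_hit {p} v w hv (by
    rintro x hx rfl; exact hpw hx)
  have hpQ : p ∉ Q.support := fun h => hQp p h rfl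
  have hsub : ∀ x ∈ (P.reverse.append Q).support, x ∈ B → x = p ∨ x = q := by
    intro x hx hxB
    rcases (SimpleGraph.Walk.mem_support_append_iff _ _).1 hx with h | h
    · exact Or.inl (hP x (by simpa using h) hxB)
    · exact Or.inr (hQ x h hxB)
  have hpq : p ≠ q := by rintro rfl; exact hpQ Q.end_mem_support
  have hpath : (P.reverse.append Q).bypass.IsPath := SimpleGraph.Walk.bypass_isPath _
  have hS := (P.reverse.append Q).support_bypass_subset_support
  have hE := (P.reverse.append Q).edges_bypass_subset_edges
  have hmem : ∀ x ∈ (P.reverse.append Q).bypass.support, x ∈ B := fun x hx =>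
    hB.2 (hB.1.union_path hpB hqB hpath) Set.subset_union_left (Or.inr hx)
  revert hpath hS hE hmem
  generalize (P.reverse.append Q).bypass = R
  intro hpath hS hE hmem
  cases R with
  | nil => exact hpq rfl
  | @cons _ x _ h R =>
    -- the second vertex of the ear can only be `q`, so the edge `pq` lies on one of the two walks
    have hx : x ∈ (SimpleGraph.Walk.cons h R).support := by simp
    obtain rfl : x = q := (hsub x (hS hx) (hmem x hx)).resolve_left h.ne'
    have he : s(p, x) ∈ (P.reverse.append Q).edges := hE (by simp)
    rw [SimpleGraph.Walk.edges_append, List.mem_append, SimpleGraph.Walk.edges_reverse,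
      List.mem_reverse] at he
    rcases he with he | he
    · exact hpq (hP x (P.snd_mem_support_of_mem_edges he) hqB).symm
    · exact hpQ (Q.fst_mem_support_of_mem_edges he)

lemma exists_walk_of_reflTransGen {a b x : V}
    (h : Relation.ReflTransGen (fun c d => LN.arc c d ∧ d ≠ x) a b) (ha : a ≠ x) :
    ∃ w : LN.undirected.Walk a b, x ∉ w.support := by
  induction h with
  | refl => exact ⟨.nil, by simpa using ha.symm⟩
  | @tail b c _ hbc ih =>
    obtain ⟨w, hw⟩ := ih
    by_cases hb : b = c
    · subst hb; exact ⟨w, hw⟩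
    · have hadj : LN.undirected.Adj b c := LN.undirected_adj hb hbc.1
      refine ⟨w.concat hadj, ?_⟩
      simp [SimpleGraph.Walk.support_concat, hw, hbc.2.symm]

/-- An arc survives the clean-up iff its tail can be reached from `*` without passing through its
head. -/
lemma cleanArc_iff {N N' : V} : LN.cleanArc N N' ↔ LN.arc N N' ∧ LN.root ≠ N' ∧
    Relation.ReflTransGen (fun a b => LN.arc a b ∧ b ≠ N') LN.root N := by
  constructor
  · rintro ⟨l, hnd, hh, hc, s, t, rfl⟩
    rw [show s ++ [N, N'] ++ t = (s ++ [N]) ++ (N' :: t) by simp] at hnd hh hc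
    have hN' : N' ∉ s ++ [N] := fun h => (List.nodup_append.1 hnd).2.2 _ h _ (by simp) rfl
    have harc : LN.arc N N' := (List.isChain_append.1 hc).2.2 N (by simp) N' (by simp)
    have hc' := hc.left_of_append
    have hN : N ∈ s ++ [N] := by simp
    rw [List.head?_append_of_ne_nil _ (by simp)] at hh
    generalize s ++ [N] = q at hN' hc' hN hh
    obtain ⟨q, rfl⟩ : ∃ q', q = LN.root :: q' := by
      cases q with
      | nil => simp at hh
      | cons a q => exact ⟨q, by simpa using hh⟩
    refine ⟨harc, fun h => hN' (by simp [h]), Relation.ReflTransGen.mono ?_ _ _ (reflTransGen_of_isChain hc' hN)⟩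
    rintro a b ⟨hab, hb⟩
    exact ⟨hab, fun h => hN' (by simp [← h, hb])⟩
  · rintro ⟨harc, hroot, h⟩
    obtain ⟨l, hnd, hh, hc⟩ := exists_nodup_isChain_of_reflTransGen h
    have hN' : N' ∉ l ++ [N] := by
      intro hm
      obtain ⟨q, hq⟩ : ∃ q', l ++ [N] = LN.root :: q' := by
        revert hh
        cases l ++ [N] with
        | nil => simp
        | cons a q => exact fun hh => ⟨q, by simpa using hh⟩
      rw [hq] at hm hc
      rcases List.mem_cons.1 hm with hm | hm
      · exact hroot hm.symm
      · obtain ⟨s, t, rfl⟩ := List.append_of_mem hm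
        rw [← List.cons_append, List.isChain_append] at hc
        obtain ⟨z, hz⟩ : ∃ z, (LN.root :: s).getLast? = some z :=
          ⟨_, List.getLast?_eq_some_getLast (by simp)⟩
        exact (hc.2.2 z hz N' (by simp)).2 rfl
    refine ⟨l ++ [N] ++ [N'], ?_, ?_, ?_, ⟨l, [], by simp⟩⟩
    · rw [List.nodup_append]
      refine ⟨hnd, by simp, ?_⟩
      rintro x hx y hy rfl
      rw [List.mem_singleton.1 hy] at hx
      exact hN' hx
    · rw [List.head?_append, hh]; rfl
    · rw [List.isChain_append]
      refine ⟨hc.imp fun _ _ h => h.1, by simp, ?_⟩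
      simpa using harc

lemma IsComponent.root_notMem {C : Component V} (hC : LN.IsComponent C) : LN.root ∉ C.nodes := by
  obtain ⟨-, B, -, hp, hn⟩ := hC
  rw [hn]
  rintro ⟨h, hne, -⟩
  have := hp.2.2 _ h .nil
  simp only [SimpleGraph.Walk.support_nil, List.mem_singleton] at this
  exact hne this.symm

lemma IsComponent.parent_notMem {C : Component V} (hC : LN.IsComponent C) :
    C.parent ∉ C.nodes := by
  obtain ⟨-, B, -, hp, hn⟩ := hC
  rw [hn]
  exact fun h => h.2.1 rfl

lemma IsComponent.mem_support {C : Component V} (hC : LN.IsComponent C) {N : V} (hN : N ∈ C.nodes)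
    (w : LN.undirected.Walk LN.root N) : C.parent ∈ w.support := by
  obtain ⟨-, B, -, hp, hn⟩ := hC
  rw [hn] at hN
  exact hp.2.2 _ hN.1 w

/-- Two blocks that share a vertex other than a parent have the same parent. -/
lemma IsParent.eq_of_mem {B B' : Set V} {p p' v : V} (hB : LN.IsBlock B) (hB' : LN.IsBlock B')
    (hp : LN.IsParent p B) (hp' : LN.IsParent p' B') (hv : v ∈ B) (hv' : v ∈ B') (hvp : v ≠ p)
    (hvp' : v ≠ p') : p = p' := by
  by_contra hne
  -- from a parent reached without the other, `v` can be reached inside the block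
  have aux : ∀ {B B' : Set V} {p p' : V}, LN.IsBlock B → LN.IsParent p B → LN.IsParent p' B' →
      v ∈ B → v ∈ B' → v ≠ p' → p ≠ p' → ∀ w : LN.undirected.Walk LN.root p, p' ∉ w.support →
      False := by
    intro B B' p p' hB hp hp' hv hv' hvp' hne w hw
    obtain ⟨Q⟩ := (hB.1.connected_diff p').preconnected ⟨p, hp.1, hne⟩ ⟨v, hv, hvp'⟩
    let Q' : LN.undirected.Walk p v := Q.map (SimpleGraph.Embedding.induce _).toHom
    have hQ : p' ∉ Q'.support := by
      have hmap : Q'.support = Q.support.map Subtype.val := SimpleGraph.Walk.support_map _ _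
      intro h
      rw [hmap, List.mem_map] at h
      obtain ⟨⟨x, hx⟩, -, h⟩ := h
      exact hx.2 h
    rcases (SimpleGraph.Walk.mem_support_append_iff w Q').1 (hp'.2.2 v hv' _) with h | h
    · exact hw h
    · exact hQ h
  obtain ⟨w, hpath⟩ := hp.2.1.exists_isPath
  by_cases hw : p' ∈ w.support
  · exact aux hB' hp' hp hv' hv hvp (Ne.symm hne) (w.takeUntil p' hw)
      (SimpleGraph.Walk.endpoint_notMem_support_takeUntil hpath hw hne)
  · exact aux hB hp hp' hv hv' hvp' hne w hw

lemma IsComponent.eq_of_mem {C C' : Component V} (hC : LN.IsComponent C)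
    (hC' : LN.IsComponent C') {v : V} (hv : v ∈ C.nodes) (hv' : v ∈ C'.nodes) : C = C' := by
  obtain ⟨-, B, hB, hp, hn⟩ := hC
  obtain ⟨-, B', hB', hp', hn'⟩ := hC'
  rw [hn] at hv
  rw [hn'] at hv'
  have hpp := hp.eq_of_mem LN hB hB' hp' hv.1 hv'.1 hv.2.1 hv'.2.1
  have hu : IsBiconnected LN.undirected (B ∪ B') :=
    hB.1.union hB'.1 hv.2.1 hv.1 hv'.1 hp.1 (hpp ▸ hp'.1)
  have hBB : B = B' :=
    (Set.Subset.antisymm Set.subset_union_left (hB.2 hu Set.subset_union_left)).trans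
      (Set.Subset.antisymm Set.subset_union_right (hB'.2 hu Set.subset_union_right)).symm
  cases C; cases C'
  simp_all

/-- Every arc that survives the clean-up belongs to a component: its head is a vertex of the
component, its tail is another one or the parent. -/
lemma exists_isComponent_of_cleanArc [Finite V] {N N' : V} (h : LN.cleanArc N N') :
    ∃ C, LN.IsComponent C ∧ N' ∈ C.nodes ∧ (N ∈ C.nodes ∨ N = C.parent) := by
  obtain ⟨harc, hroot, hN⟩ := LN.cleanArc_iff.1 h
  obtain ⟨w, hw⟩ := LN.exists_walk_of_reflTransGen hN hroot
  have hne : N ≠ N' := by rintro rfl; exact hw w.end_mem_support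
  obtain ⟨B, hB, hNB, hNB'⟩ :=
    LN.exists_isBlock (LN.undirected_adj hne harc)
  obtain ⟨p, hp⟩ := hB.exists_isParent LN hNB ⟨w⟩
  have hrN : Relation.ReflTransGen LN.arc LN.root N := 
    Relation.ReflTransGen.mono (fun _ _ h => h.1) _ _ hN
  have hmem : N' ∈ {v | v ∈ B ∧ v ≠ p ∧ Relation.ReflTransGen LN.arc LN.root v} :=
    ⟨hNB', by rintro rfl; exact hw (hp.2.2 _ hNB w), hrN.tail harc⟩
  refine ⟨⟨_, p⟩, ⟨⟨N', hmem⟩, B, hB, hp, rfl⟩, hmem, ?_⟩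
  by_cases hNp : N = p
  · exact Or.inr hNp
  · exact Or.inl ⟨hNB, hNp, hrN⟩

/-- A surviving arc that does not start at `*` follows another one. -/
lemma exists_cleanArc_of_cleanArc {N N' : V} (h : LN.cleanArc N N') (hN : N ≠ LN.root) :
    ∃ N₀, LN.cleanArc N₀ N := by
  obtain ⟨l, hnd, hh, hc, s, t, rfl⟩ := h
  rcases List.eq_nil_or_concat s with rfl | ⟨s, z, rfl⟩
  · simp at hh; exact absurd hh hN
  · exact ⟨z, _, hnd, hh, hc, s, N' :: t, by simp⟩

end LogicalNetwork

namespace LogicalNetwork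

variable {V M Config Act Obs Port : Type*} (LN : LogicalNetwork V M Config Act Obs Port)

/-! ### A single attack step -/

section Step

variable {E E' : V → V → Prop} {src src' : V} {C C' : Set V}

/-- The status of the attacked machine after an action. -/
def status (E : V → V → Prop) (src : V) (C : Set V) (s : LN.AttackState C)
    (m : LN.Machines C) (a : Act) : Option Config :=
  match s m with
  | none => none
  | some c => if LN.Usable E src C s m a then LN.outcome m a c else some c

lemma nextState_eq_update (s : LN.AttackState C) (m : LN.Machines C) (a : Act) :
    LN.nextState E src C s m a = Function.update s m (LN.status E src C s m a) := by
  unfold nextState status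
  cases h : s m with
  | none => simp [← h]
  | some c => by_cases hu : LN.Usable E src C s m a <;> simp [hu, ← h]

lemma response_eq_succeeded_iff (s : LN.AttackState C) (m : LN.Machines C) (a : Act) :
    LN.response E src C s m a = .succeeded ↔ s m ≠ none ∧ LN.status E src C s m a = none := by
  unfold response status
  cases h : s m with
  | none => simp
  | some c =>
    by_cases hu : LN.Usable E src C s m a <;> by_cases ho : LN.outcome m a c = none <;>
      simp [hu, ho]

lemma usable_of_response_eq_succeeded {s : LN.AttackState C} {m : LN.Machines C} {a : Act}
    (h : LN.response E src C s m a = .succeeded) : LN.Usable E src C s m a := by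
  unfold response at h
  cases hs : s m with
  | none => simp [hs] at h
  | some c =>
    by_contra hu
    simp [hs, hu] at h

lemma stepReward_eq (pr : V → ℝ) (s : LN.AttackState C) (m : LN.Machines C) (a : Act) :
    LN.stepReward E src C pr s m a = LN.timeReward m a + LN.riskReward m a +
      (if LN.response E src C s m a = .succeeded then
        LN.value m + (if LN.Controlled src C s (LN.subnet m) then 0 else pr (LN.subnet m))
      else 0) := by
  unfold stepReward
  rw [nextState_eq_update, Function.update_self]
  simp only [response_eq_succeeded_iff]

lemma controlled_nextState_iff {s : LN.AttackState C} {m : LN.Machines C} {a : Act} {N : V} :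
    LN.Controlled src' C (LN.nextState E src C s m a) N ↔ LN.Controlled src' C s N ∨
      (N = LN.subnet m ∧ LN.response E src C s m a = .succeeded) := by
  have hnone : s m = none → LN.status E src C s m a = none := fun h => by simp [status, h]
  rw [nextState_eq_update, response_eq_succeeded_iff]
  constructor
  · rintro (h | ⟨m', hm', h⟩)
    · exact Or.inl (Or.inl h)
    · by_cases hmm : m' = m
      · subst hmm
        rw [Function.update_self] at h
        by_cases hs : s m' = none
        · exact Or.inl (Or.inr ⟨m', hm', hs⟩)
        · exact Or.inr ⟨hm'.symm, hs, h⟩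
      · rw [Function.update_of_ne hmm] at h
        exact Or.inl (Or.inr ⟨m', hm', h⟩)
  · rintro ((h | ⟨m', hm', h⟩) | ⟨rfl, -, h⟩)
    · exact Or.inl h
    · refine Or.inr ⟨m', hm', ?_⟩
      by_cases hmm : m' = m
      · subst hmm; rw [Function.update_self]; exact hnone h
      · rwa [Function.update_of_ne hmm]
    · exact Or.inr ⟨m, rfl, by rwa [Function.update_self]⟩

lemma status_congr {s : LN.AttackState C} {s' : LN.AttackState C'} {m : LN.Machines C}
    {m' : LN.Machines C'} {a : Act} (hm : m.1 = m'.1) (hs : s m = s' m')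
    (hu : LN.Usable E src C s m a ↔ LN.Usable E' src' C' s' m' a) :
    LN.status E src C s m a = LN.status E' src' C' s' m' a := by
  simp only [status, hm, hs, hu]

lemma response_congr {s : LN.AttackState C} {s' : LN.AttackState C'} {m : LN.Machines C}
    {m' : LN.Machines C'} {a : Act} (hm : m.1 = m'.1) (hs : s m = s' m')
    (hu : LN.Usable E src C s m a ↔ LN.Usable E' src' C' s' m' a) :
    LN.response E src C s m a = LN.response E' src' C' s' m' a := by
  simp only [response, hm, hs, hu]

lemma stepReward_congr {s : LN.AttackState C} {s' : LN.AttackState C'} {m : LN.Machines C}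
    {m' : LN.Machines C'} {a : Act} (hm : m.1 = m'.1) (hs : s m = s' m')
    (hu : LN.Usable E src C s m a ↔ LN.Usable E' src' C' s' m' a)
    (hc : LN.Controlled src C s (LN.subnet m) ↔ LN.Controlled src' C' s' (LN.subnet m'))
    (pr : V → ℝ) :
    LN.stepReward E src C pr s m a = LN.stepReward E' src' C' pr s' m' a := by
  rw [hm] at hc
  simp only [stepReward_eq, LN.response_congr hm hs hu, hm, hc]

lemma nextState_of_not_usable {s : LN.AttackState C} {m : LN.Machines C} {a : Act}
    (hu : ¬ LN.Usable E src C s m a) : LN.nextState E src C s m a = s := by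
  unfold nextState
  cases h : s m <;> simp [hu]

lemma response_of_not_usable {s : LN.AttackState C} {m : LN.Machines C} {a : Act}
    (hu : ¬ LN.Usable E src C s m a) : LN.response E src C s m a = .nothing := by
  unfold response
  cases h : s m <;> simp [hu]

lemma stepReward_nonpos_of_not_usable {s : LN.AttackState C} {m : LN.Machines C} {a : Act}
    (hu : ¬ LN.Usable E src C s m a) (pr : V → ℝ) : LN.stepReward E src C pr s m a ≤ 0 := by
  rw [stepReward_eq, LN.response_of_not_usable hu]
  have := LN.timeReward_nonpos m a
  have := LN.riskReward_nonpos m a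
  simp
  linarith

lemma stepReward_update (pr : V → ℝ) (p : V) (v : ℝ) (s : LN.AttackState C)
    (m : LN.Machines C) (a : Act) :
    LN.stepReward E src C (Function.update pr p (pr p + v)) s m a =
      LN.stepReward E src C pr s m a +
        (if LN.response E src C s m a = .succeeded ∧ LN.subnet m = p ∧ ¬ LN.Controlled src C s p
          then v else 0) := by
  rw [stepReward_eq, stepReward_eq]
  by_cases hr : LN.response E src C s m a = .succeeded
  · by_cases hp : LN.subnet m = p
    · by_cases hc : LN.Controlled src C s p
      · simp [hr, hp, hc]
      · simp [hr, hp, hc]; ring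
    · simp [hr, hp]
  · simp [hr]

end Step

/-! ### States that an attack from `*` can produce -/

/-- The controlled subnetworks form a set that the attack can have spread over: each is linked to
`*` by a directed path through controlled subnetworks. -/
def Spread (W : Set V) (s : LN.AttackState W) : Prop :=
  ∀ N, LN.Controlled LN.root W s N →
    Relation.ReflTransGen (fun a b => LN.arc a b ∧ LN.Controlled LN.root W s b) LN.root N

lemma Spread.nextState {W : Set V} {s : LN.AttackState W} (hs : LN.Spread W s)
    (m : LN.Machines W) (a : Act) :
    LN.Spread W (LN.nextState LN.arc LN.root W s m a) := by
  have mono : ∀ N, LN.Controlled LN.root W s N → Relation.ReflTransGen (fun a' b => LN.arc a' b ∧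
      LN.Controlled LN.root W (LN.nextState LN.arc LN.root W s m a) b) LN.root N := fun N hN =>
    Relation.ReflTransGen.mono
      (fun _ _ h => ⟨h.1, LN.controlled_nextState_iff.2 (Or.inl h.2)⟩) _ _ (hs N hN)
  intro N hN
  rcases LN.controlled_nextState_iff.1 hN with h | ⟨rfl, h⟩
  · exact mono N h
  · rcases LN.usable_of_response_eq_succeeded h with h | ⟨N', hN', harc, -⟩
    · exact mono _ h
    · exact (mono N' hN').tail ⟨harc, hN⟩

lemma spread_of_forall_ne_none {W : Set V} {s : LN.AttackState W} (h : ∀ m, s m ≠ none) :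
    LN.Spread W s := by
  rintro N (rfl | ⟨m, -, hm⟩)
  · exact .refl
  · exact absurd hm (h m)

/-- An arc removed by the clean-up is of no use: its head is controlled before its tail. -/
lemma Spread.cleanArc {W : Set V} {s : LN.AttackState W} (hs : LN.Spread W s) {N N' : V}
    (hN : LN.Controlled LN.root W s N) (hN' : ¬ LN.Controlled LN.root W s N')
    (h : LN.arc N N') : LN.cleanArc N N' := by
  refine LN.cleanArc_iff.2 ⟨h, ?_, Relation.ReflTransGen.mono ?_ _ _ (hs N hN)⟩
  · rintro rfl; exact hN' (Or.inl rfl)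
  · rintro a b ⟨hab, hb⟩
    exact ⟨hab, by rintro rfl; exact hN' hb⟩

/-! ### Splitting off a leaf component -/

/-- The subnetworks `W` split into `U` and a leaf `C`: the clean-up leaves no arc from `C` back to
`U`, arcs into `C` only from `C` itself and from `p`, and (`gate`) no vertex of `C` can be reached
from `*` without passing through `p`. Apart from a component with its parent, `C` can also be a set
of unreachable subnetworks, with `p = *`. -/
structure IsLeaf (W U C : Set V) (p : V) : Prop where
  left_subset : U ⊆ W
  right_subset : C ⊆ W
  cover : ∀ m, LN.subnet m ∈ W → LN.subnet m ∈ U ∨ LN.subnet m ∈ C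
  notMem_right : ∀ N ∈ U, N ∉ C
  root_notMem : LN.root ∉ C
  gate_notMem : p ∉ C
  no_return : ∀ N N', LN.cleanArc N N' → N ∈ C → N' ∉ U
  entry : ∀ N N', LN.cleanArc N N' → N' ∈ C → N ∈ C ∨ N = p
  gate : p ≠ LN.root → ∀ N ∈ C,
    ¬ Relation.ReflTransGen (fun a b => LN.arc a b ∧ b ≠ p) LN.root N

variable {LN}

/-- A machine of a part, as a machine of the whole. -/
def incl {U W : Set V} (h : U ⊆ W) (m : LN.Machines U) : LN.Machines W := ⟨m.1, h m.2⟩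

/-- The state of the whole with given states of the two parts. -/
def join (W : Set V) {U C : Set V} (x : LN.AttackState U) (y : LN.AttackState C) :
    LN.AttackState W := fun m =>
  if hm : LN.subnet m.1 ∈ U then x ⟨m.1, hm⟩
  else if hm' : LN.subnet m.1 ∈ C then y ⟨m.1, hm'⟩ else none

variable {W U C : Set V} {p : V} {x : LN.AttackState U} {y : LN.AttackState C}
  {pr : V → ℝ}

namespace IsLeaf

lemma exists_incl (h : LN.IsLeaf W U C p) (m : LN.Machines W) :
    (∃ u, m = incl h.left_subset u) ∨ ∃ c, m = incl h.right_subset c :=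
  (h.cover m.1 m.2).imp (fun hm => ⟨⟨m.1, hm⟩, rfl⟩) (fun hm => ⟨⟨m.1, hm⟩, rfl⟩)

lemma notMem_left (h : LN.IsLeaf W U C p) {N : V} (hN : N ∈ C) : N ∉ U :=
  fun h' => h.notMem_right N h' hN

lemma join_left (h : LN.IsLeaf W U C p) (m : LN.Machines U) :
    join W x y (incl h.left_subset m) = x m := dif_pos m.2

lemma join_right (h : LN.IsLeaf W U C p) (m : LN.Machines C) :
    join W x y (incl h.right_subset m) = y m :=
  (dif_neg (h.notMem_left m.2)).trans (dif_pos m.2)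

lemma join_ext (h : LN.IsLeaf W U C p) {z z' : LN.AttackState W}
    (hl : ∀ m, z (incl h.left_subset m) = z' (incl h.left_subset m))
    (hr : ∀ m, z (incl h.right_subset m) = z' (incl h.right_subset m)) : z = z' := by
  funext m
  rcases h.exists_incl m with ⟨m, rfl⟩ | ⟨m, rfl⟩
  exacts [hl m, hr m]

lemma incl_ne (h : LN.IsLeaf W U C p) (m : LN.Machines U) (m' : LN.Machines C) :
    incl h.left_subset m ≠ incl h.right_subset m' := by
  intro e
  have e' : m.1 = m'.1 := congrArg (fun q : LN.Machines W => q.1) e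
  exact h.notMem_right _ m.2 (e' ▸ m'.2)

lemma incl_injective (hUW : U ⊆ W) : Function.Injective (incl (LN := LN) hUW) := by
  intro m m' e
  exact Subtype.ext (congrArg (fun q : LN.Machines W => q.1) e)

lemma update_left (h : LN.IsLeaf W U C p) (m : LN.Machines U) (c : Option Config) :
    Function.update (join W x y) (incl h.left_subset m) c = join W (Function.update x m c) y := by
  refine h.join_ext (fun m' => ?_) (fun m' => ?_)
  · rw [h.join_left]
    by_cases hm : m' = m
    · subst hm; simp
    · rw [Function.update_of_ne hm, Function.update_of_ne ((incl_injective _).ne hm), h.join_left]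
  · rw [Function.update_of_ne (h.incl_ne m m').symm, h.join_right, h.join_right]

lemma update_right (h : LN.IsLeaf W U C p) (m : LN.Machines C) (c : Option Config) :
    Function.update (join W x y) (incl h.right_subset m) c =
      join W x (Function.update y m c) := by
  refine h.join_ext (fun m' => ?_) (fun m' => ?_)
  · rw [Function.update_of_ne (h.incl_ne m' m), h.join_left, h.join_left]
  · rw [h.join_right]
    by_cases hm : m' = m
    · subst hm; simp
    · rw [Function.update_of_ne hm, Function.update_of_ne ((incl_injective _).ne hm), h.join_right]

lemma controlled_join (h : LN.IsLeaf W U C p) {src N : V} :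
    LN.Controlled src W (join W x y) N ↔ LN.Controlled src U x N ∨ LN.Controlled src C y N := by
  constructor
  · rintro (hN | ⟨m, hm, hs⟩)
    · exact Or.inl (Or.inl hN)
    · rcases h.exists_incl m with ⟨m, rfl⟩ | ⟨m, rfl⟩
      · rw [h.join_left] at hs
        exact Or.inl (Or.inr ⟨m, hm, hs⟩)
      · rw [h.join_right] at hs
        exact Or.inr (Or.inr ⟨m, hm, hs⟩)
  · rintro ((hN | ⟨m, hm, hs⟩) | (hN | ⟨m, hm, hs⟩))
    · exact Or.inl hN
    · exact Or.inr ⟨incl h.left_subset m, hm, by rwa [h.join_left]⟩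
    · exact Or.inl hN
    · exact Or.inr ⟨incl h.right_subset m, hm, by rwa [h.join_right]⟩

lemma controlled_join_left (h : LN.IsLeaf W U C p) {src N : V} (hN : N ∉ C) :
    LN.Controlled src W (join W x y) N ↔ LN.Controlled src U x N := by
  rw [h.controlled_join]
  refine ⟨?_, Or.inl⟩
  rintro (h' | h' | ⟨m, rfl, -⟩)
  exacts [h', Or.inl h', absurd m.2 hN]

lemma controlled_join_right (h : LN.IsLeaf W U C p) {N : V} (hN : N ∈ C) :
    LN.Controlled LN.root W (join W x y) N ↔ LN.Controlled p C y N := by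
  rw [h.controlled_join]
  constructor
  · rintro ((h' | ⟨m, rfl, -⟩) | (h' | h'))
    · exact absurd (h' ▸ hN) h.root_notMem
    · exact absurd hN (h.notMem_right _ m.2)
    · exact absurd (h' ▸ hN) h.root_notMem
    · exact Or.inr h'
  · rintro (h' | h')
    · exact absurd (h' ▸ hN) h.gate_notMem
    · exact Or.inr (Or.inr h')

lemma usable_left (h : LN.IsLeaf W U C p) (hs : LN.Spread W (join W x y)) (m : LN.Machines U)
    (a : Act) : LN.Usable LN.arc LN.root W (join W x y) (incl h.left_subset m) a ↔
      LN.Usable LN.arc LN.root U x m a := by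
  have hm : LN.Controlled LN.root W (join W x y) (LN.subnet m.1) ↔
      LN.Controlled LN.root U x (LN.subnet m.1) :=
    h.controlled_join_left (h.notMem_right _ m.2)
  constructor
  · rintro (hc | ⟨N, hN, harc, hport⟩)
    · exact Or.inl (hm.1 hc)
    · by_cases hc : LN.Controlled LN.root W (join W x y) (LN.subnet m.1)
      · exact Or.inl (hm.1 hc)
      · have hNC : N ∉ C := fun hNC => h.no_return _ _ (hs.cleanArc LN hN hc harc) hNC m.2
        exact Or.inr ⟨N, (h.controlled_join_left hNC).1 hN, harc, hport⟩
  · rintro (hc | ⟨N, hN, harc, hport⟩)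
    · exact Or.inl (hm.2 hc)
    · exact Or.inr ⟨N, h.controlled_join.2 (Or.inl hN), harc, hport⟩

lemma usable_right (h : LN.IsLeaf W U C p) (hs : LN.Spread W (join W x y))
    (hp : LN.Controlled LN.root U x p) (m : LN.Machines C) (a : Act) :
    LN.Usable LN.arc LN.root W (join W x y) (incl h.right_subset m) a ↔
      LN.Usable LN.cleanArc p C y m a := by
  have hm : LN.Controlled LN.root W (join W x y) (LN.subnet m.1) ↔
      LN.Controlled p C y (LN.subnet m.1) := h.controlled_join_right m.2
  constructor
  · rintro (hc | ⟨N, hN, harc, hport⟩)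
    · exact Or.inl (hm.1 hc)
    · by_cases hc : LN.Controlled LN.root W (join W x y) (LN.subnet m.1)
      · exact Or.inl (hm.1 hc)
      · have hclean := hs.cleanArc LN hN hc harc
        refine Or.inr ⟨N, ?_, hclean, hport⟩
        rcases h.entry _ _ hclean m.2 with hNC | rfl
        · exact (h.controlled_join_right hNC).1 hN
        · exact Or.inl rfl
  · rintro (hc | ⟨N, hN, hclean, hport⟩)
    · exact Or.inl (hm.2 hc)
    · have harc : LN.arc N (LN.subnet m.1) := (LN.cleanArc_iff.1 hclean).1
      refine Or.inr ⟨N, ?_, harc, hport⟩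
      rcases hN with rfl | ⟨m', hm', hc⟩
      · exact h.controlled_join.2 (Or.inl hp)
      · exact h.controlled_join.2 (Or.inr (Or.inr ⟨m', hm', hc⟩))

lemma not_usable_right (h : LN.IsLeaf W U C p) (hs : LN.Spread W (join W x y))
    (hp : ¬ LN.Controlled LN.root U x p) (m : LN.Machines C) (a : Act) :
    ¬ LN.Usable LN.arc LN.root W (join W x y) (incl h.right_subset m) a := by
  have hpr : p ≠ LN.root := fun e => hp (Or.inl e)
  have hpW : ¬ LN.Controlled LN.root W (join W x y) p := fun hc =>
    hp ((h.controlled_join_left h.gate_notMem).1 hc)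
  have avoid : ∀ N, LN.Controlled LN.root W (join W x y) N →
      Relation.ReflTransGen (fun a b => LN.arc a b ∧ b ≠ p) LN.root N := fun N hN =>
    Relation.ReflTransGen.mono (fun a b hab => ⟨hab.1, fun e => hpW (e ▸ hab.2)⟩) _ _ (hs N hN)
  rintro (hc | ⟨N, hN, harc, -⟩)
  · exact h.gate hpr _ m.2 (avoid _ hc)
  · exact h.gate hpr _ m.2 ((avoid N hN).tail ⟨harc, fun e => h.gate_notMem (e ▸ m.2)⟩)

/-! ### Attack steps in the two parts -/

lemma response_left (h : LN.IsLeaf W U C p) (hs : LN.Spread W (join W x y)) (m : LN.Machines U)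
    (a : Act) : LN.response LN.arc LN.root W (join W x y) (incl h.left_subset m) a =
      LN.response LN.arc LN.root U x m a :=
  LN.response_congr (by rfl) (h.join_left m) (h.usable_left hs m a)

lemma nextState_left (h : LN.IsLeaf W U C p) (hs : LN.Spread W (join W x y)) (m : LN.Machines U)
    (a : Act) : LN.nextState LN.arc LN.root W (join W x y) (incl h.left_subset m) a =
      join W (LN.nextState LN.arc LN.root U x m a) y := by
  rw [nextState_eq_update, nextState_eq_update, h.update_left,
    LN.status_congr (by rfl) (h.join_left m) (h.usable_left hs m a)]

lemma stepReward_left (h : LN.IsLeaf W U C p) (hs : LN.Spread W (join W x y))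
    (m : LN.Machines U) (a : Act) :
    LN.stepReward LN.arc LN.root W pr (join W x y) (incl h.left_subset m) a =
      LN.stepReward LN.arc LN.root U pr x m a :=
  LN.stepReward_congr (by rfl) (h.join_left m) (h.usable_left hs m a)
    (h.controlled_join_left (h.notMem_right _ m.2)) pr

lemma response_right (h : LN.IsLeaf W U C p) (hs : LN.Spread W (join W x y))
    (hp : LN.Controlled LN.root U x p) (m : LN.Machines C) (a : Act) :
    LN.response LN.arc LN.root W (join W x y) (incl h.right_subset m) a =
      LN.response LN.cleanArc p C y m a :=
  LN.response_congr (by rfl) (h.join_right m) (h.usable_right hs hp m a)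

lemma nextState_right (h : LN.IsLeaf W U C p) (hs : LN.Spread W (join W x y))
    (hp : LN.Controlled LN.root U x p) (m : LN.Machines C) (a : Act) :
    LN.nextState LN.arc LN.root W (join W x y) (incl h.right_subset m) a =
      join W x (LN.nextState LN.cleanArc p C y m a) := by
  rw [nextState_eq_update, nextState_eq_update, h.update_right,
    LN.status_congr (by rfl) (h.join_right m) (h.usable_right hs hp m a)]

lemma stepReward_right (h : LN.IsLeaf W U C p) (hs : LN.Spread W (join W x y))
    (hp : LN.Controlled LN.root U x p) (m : LN.Machines C) (a : Act) :
    LN.stepReward LN.arc LN.root W pr (join W x y) (incl h.right_subset m) a =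
      LN.stepReward LN.cleanArc p C pr y m a :=
  LN.stepReward_congr (by rfl) (h.join_right m) (h.usable_right hs hp m a)
    (h.controlled_join_right m.2) pr

end IsLeaf

end LogicalNetwork

namespace LogicalNetwork

variable {V M Config Act Obs Port : Type*} {LN : LogicalNetwork V M Config Act Obs Port}

/-! ### Combining plans and taking them apart -/

/-- A plan against a part, as a plan against the whole. -/
def liftPlan {U W : Set V} (h : U ⊆ W) (T : LN.Plan U) : LN.Plan W :=
  T.mapAct fun q => (incl h q.1, q.2)

/-- Carry out a plan against `U`, interrupted by the plan `TC` against `C` when `p` first comes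
under control. -/
def graft {U C W : Set V} (hU : U ⊆ W) (hC : C ⊆ W) (p : V) (TC : LN.Plan C) :
    LN.Plan U → LN.Plan W
  | .halt => .halt
  | .act q k => .act (incl hU q.1, q.2) fun o =>
      if o = .succeeded ∧ LN.subnet q.1.1 = p then (liftPlan hC TC).seq (liftPlan hU (k o))
      else graft hU hC p TC (k o)

/-- The plan against `U` contained in a plan against the whole, for a fixed state `y` of `C`, whose
reactions are simulated. The proposition `g` says whether the entry `p` to `C` is under control; as
long as it is not, the actions against `C` have no effect. -/
def leftPart {W : Set V} (U C : Set V) (p : V) :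
    LN.Plan W → Prop → LN.AttackState C → LN.Plan U
  | .halt, _, _ => .halt
  | .act q k, g, y =>
      if hm : LN.subnet q.1.1 ∈ U then
        .act (⟨q.1.1, hm⟩, q.2) fun o =>
          leftPart U C p (k o) (g ∨ o = .succeeded ∧ LN.subnet q.1.1 = p) y
      else if hm' : LN.subnet q.1.1 ∈ C then
        if g then
          leftPart U C p (k (LN.response LN.cleanArc p C y ⟨q.1.1, hm'⟩ q.2)) g
            (LN.nextState LN.cleanArc p C y ⟨q.1.1, hm'⟩ q.2)
        else leftPart U C p (k .nothing) g y
      else .halt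

/-- The plan against `C` contained in a plan against the whole, for a fixed state of `U`, whose
reactions are simulated. -/
def rightPart {W : Set V} (U C : Set V) : LN.Plan W → LN.AttackState U → LN.Plan C
  | .halt, _ => .halt
  | .act q k, x =>
      if hm : LN.subnet q.1.1 ∈ U then
        rightPart U C (k (LN.response LN.arc LN.root U x ⟨q.1.1, hm⟩ q.2))
          (LN.nextState LN.arc LN.root U x ⟨q.1.1, hm⟩ q.2)
      else if hm' : LN.subnet q.1.1 ∈ C then
        .act (⟨q.1.1, hm'⟩, q.2) fun o => rightPart U C (k o) x
      else .halt

namespace IsLeaf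

variable {W U C : Set V} {p : V} {x : LN.AttackState U} {y : LN.AttackState C} {pr : V → ℝ} {v : ℝ}

lemma leftPart_incl_left (h : LN.IsLeaf W U C p) (m : LN.Machines U) (a : Act)
    (k : Response Obs → LN.Plan W) (g : Prop) (y : LN.AttackState C) :
    leftPart U C p (.act (incl h.left_subset m, a) k) g y =
      .act (m, a) fun o => leftPart U C p (k o) (g ∨ o = .succeeded ∧ LN.subnet m.1 = p) y :=
  dif_pos m.2

lemma leftPart_incl_right (h : LN.IsLeaf W U C p) (m : LN.Machines C) (a : Act)
    (k : Response Obs → LN.Plan W) (g : Prop) (y : LN.AttackState C) :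
    leftPart U C p (.act (incl h.right_subset m, a) k) g y =
      if g then leftPart U C p (k (LN.response LN.cleanArc p C y m a)) g
        (LN.nextState LN.cleanArc p C y m a)
      else leftPart U C p (k .nothing) g y :=
  (dif_neg (h.notMem_left m.2)).trans (dif_pos m.2)

lemma rightPart_incl_left (h : LN.IsLeaf W U C p) (m : LN.Machines U) (a : Act)
    (k : Response Obs → LN.Plan W) (x : LN.AttackState U) :
    rightPart U C (.act (incl h.left_subset m, a) k) x =
      rightPart U C (k (LN.response LN.arc LN.root U x m a))
        (LN.nextState LN.arc LN.root U x m a) :=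
  dif_pos m.2

lemma rightPart_incl_right (h : LN.IsLeaf W U C p) (m : LN.Machines C) (a : Act)
    (k : Response Obs → LN.Plan W) (x : LN.AttackState U) :
    rightPart U C (.act (incl h.right_subset m, a) k) x =
      .act (m, a) fun o => rightPart U C (k o) x :=
  (dif_neg (h.notMem_left m.2)).trans (dif_pos m.2)

lemma stepReward_update_of_controlled {E : V → V → Prop} {src : V}
    (hp : LN.Controlled src U x p) (m : LN.Machines U) (a : Act) :
    LN.stepReward E src U (Function.update pr p (pr p + v)) x m a =
      LN.stepReward E src U pr x m a := by
  rw [stepReward_update, if_neg (fun h => h.2.2 hp), add_zero]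

lemma gain_liftPlan_left (h : LN.IsLeaf W U C p) (T : LN.Plan U)
    (hs : LN.Spread W (join W x y)) (hp : LN.Controlled LN.root U x p) :
    LN.gain LN.arc LN.root W pr (liftPlan h.left_subset T) (join W x y) =
      LN.gain LN.arc LN.root U (Function.update pr p (pr p + v)) T x := by
  induction T generalizing x with
  | halt => rfl
  | act q k ih =>
    obtain ⟨m, a⟩ := q
    have hs' := hs.nextState LN (incl h.left_subset m) a
    rw [h.nextState_left hs] at hs'
    simp only [liftPlan, DecisionTree.mapAct] at ih ⊢
    rw [gain_act, gain_act, h.response_left hs, h.nextState_left hs, h.stepReward_left hs,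
      ih _ hs' (LN.controlled_nextState_iff.2 (Or.inl hp)), stepReward_update_of_controlled hp]

lemma gain_seq_liftPlan (h : LN.IsLeaf W U C p) (TC : LN.Plan C) (T : LN.Plan U)
    (hs : LN.Spread W (join W x y)) (hp : LN.Controlled LN.root U x p) :
    LN.gain LN.arc LN.root W pr ((liftPlan h.right_subset TC).seq (liftPlan h.left_subset T))
        (join W x y) =
      LN.gain LN.cleanArc p C pr TC y +
        LN.gain LN.arc LN.root U (Function.update pr p (pr p + v)) T x := by
  induction TC generalizing y with
  | halt =>
    rw [gain_halt, zero_add, ← h.gain_liftPlan_left T hs hp]; rfl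
  | act q k ih =>
    obtain ⟨m, a⟩ := q
    have hs' := hs.nextState LN (incl h.right_subset m) a
    rw [h.nextState_right hs hp] at hs'
    have ih' := ih (LN.response LN.cleanArc p C y m a) hs'
    simp only [liftPlan, DecisionTree.mapAct, DecisionTree.seq] at ih' ⊢
    rw [gain_act, gain_act, h.response_right hs hp, h.nextState_right hs hp,
      h.stepReward_right hs hp, ih', add_assoc]

/-- Once `p` is under control, the two parts do not interact, and the reward of a plan splits. -/
lemma gain_eq_add (h : LN.IsLeaf W U C p) (T : LN.Plan W) {g : Prop} (hg : g)
    (hs : LN.Spread W (join W x y)) (hp : LN.Controlled LN.root U x p) :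
    LN.gain LN.arc LN.root W pr T (join W x y) =
      LN.gain LN.arc LN.root U (Function.update pr p (pr p + v)) (leftPart U C p T g y) x +
        LN.gain LN.cleanArc p C pr (rightPart U C T x) y := by
  induction T generalizing x y g with
  | halt => simp [leftPart, rightPart]
  | act q k ih =>
    obtain ⟨m, a⟩ := q
    have hs' := hs.nextState LN m a
    rcases h.exists_incl m with ⟨m, rfl⟩ | ⟨m, rfl⟩
    · rw [h.nextState_left hs] at hs'
      rw [h.leftPart_incl_left, h.rightPart_incl_left, gain_act, gain_act, h.response_left hs,
        h.nextState_left hs, h.stepReward_left hs,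
        ih _ (Or.inl hg) hs' (LN.controlled_nextState_iff.2 (Or.inl hp)),
        stepReward_update_of_controlled hp, add_assoc]
    · rw [h.nextState_right hs hp] at hs'
      rw [h.leftPart_incl_right, h.rightPart_incl_right, gain_act, gain_act,
        h.response_right hs hp, h.nextState_right hs hp, h.stepReward_right hs hp, if_pos hg,
        ih _ hg hs' hp]
      ring

end IsLeaf

/-! ### Independent initial configurations -/

section Belief

variable [Fintype M]

lemma initialBelief_eq_prod {C : Set V} (s : LN.AttackState C) :
    LN.initialBelief C s = ∏ m : LN.Machines C, (s m).elim 0 (LN.belief m) := by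
  refine Finset.prod_congr rfl fun m _ => ?_
  cases s m <;> rfl

lemma initialBelief_nonneg {C : Set V} (s : LN.AttackState C) : 0 ≤ LN.initialBelief C s := by
  rw [initialBelief_eq_prod]
  refine Finset.prod_nonneg fun m _ => ?_
  cases s m with
  | none => exact le_rfl
  | some c => exact LN.belief_nonneg _ _

lemma ne_none_of_initialBelief_ne_zero {C : Set V} {s : LN.AttackState C}
    (h : LN.initialBelief C s ≠ 0) (m : LN.Machines C) : s m ≠ none := by
  intro hm
  rw [initialBelief_eq_prod] at h
  exact h (Finset.prod_eq_zero (Finset.mem_univ m) (by simp [hm]))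

lemma sum_initialBelief [Fintype Config] (C : Set V) :
    ∑ s : LN.AttackState C, LN.initialBelief C s = 1 := by
  simp only [initialBelief_eq_prod]
  rw [← Fintype.prod_sum (fun (m : LN.Machines C) (o : Option Config) =>
    o.elim 0 (LN.belief m))]
  refine Finset.prod_eq_one fun m _ => ?_
  rw [Fintype.sum_option, ← LN.belief_sum m, finsum_eq_sum_of_fintype]
  simp

variable {W U C : Set V} {p : V}

/-- The machines of the whole are those of the two parts. -/
def IsLeaf.machinesEquiv (h : LN.IsLeaf W U C p) :
    LN.Machines U ⊕ LN.Machines C ≃ LN.Machines W :=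
  Equiv.ofBijective (Sum.elim (incl h.left_subset) (incl h.right_subset)) <| by
    constructor
    · exact (IsLeaf.incl_injective _).sumElim (IsLeaf.incl_injective _) h.incl_ne
    · intro m
      rcases h.exists_incl m with ⟨u, rfl⟩ | ⟨c, rfl⟩
      exacts [⟨Sum.inl u, rfl⟩, ⟨Sum.inr c, rfl⟩]

lemma IsLeaf.initialBelief_join (h : LN.IsLeaf W U C p) (x : LN.AttackState U)
    (y : LN.AttackState C) :
    LN.initialBelief W (join W x y) = LN.initialBelief U x * LN.initialBelief C y := by
  simp only [initialBelief_eq_prod]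
  rw [← h.machinesEquiv.prod_comp, Fintype.prod_sum_type]
  congr 1
  · exact Finset.prod_congr rfl fun m _ => congrArg (Option.elim · 0 (LN.belief m)) (h.join_left m)
  · exact Finset.prod_congr rfl fun m _ => congrArg (Option.elim · 0 (LN.belief m)) (h.join_right m)

lemma IsLeaf.spread_nextState_left (h : LN.IsLeaf W U C p) {x : LN.AttackState U}
    (hs : ∀ y : LN.AttackState C, LN.initialBelief C y ≠ 0 → LN.Spread W (join W x y))
    (m : LN.Machines U) (a : Act) (y : LN.AttackState C) (hy : LN.initialBelief C y ≠ 0) :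
    LN.Spread W (join W (LN.nextState LN.arc LN.root U x m a) y) := by
  have := (hs y hy).nextState LN (incl h.left_subset m) a
  rwa [h.nextState_left (hs y hy)] at this

lemma IsLeaf.spread_join (h : LN.IsLeaf W U C p) {x : LN.AttackState U} (hx : LN.initialBelief U x ≠ 0) (y : LN.AttackState C)
    (hy : LN.initialBelief C y ≠ 0) : LN.Spread W (join W x y) :=
  LN.spread_of_forall_ne_none <| ne_none_of_initialBelief_ne_zero <| by
    rw [h.initialBelief_join]; exact mul_ne_zero hx hy

lemma not_controlled_of_initialBelief_ne_zero {x : LN.AttackState U} (hx : LN.initialBelief U x ≠ 0)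
    (hp : p ≠ LN.root) : ¬ LN.Controlled LN.root U x p := by
  rintro (h | ⟨m, -, hm⟩)
  · exact hp h
  · exact ne_none_of_initialBelief_ne_zero hx m hm

variable [Fintype Config]

lemma IsLeaf.sum_join (h : LN.IsLeaf W U C p) (f : LN.AttackState W → ℝ) :
    ∑ z, LN.initialBelief W z * f z =
      ∑ x, LN.initialBelief U x * ∑ y, LN.initialBelief C y * f (join W x y) := by
  have hbij : Function.Bijective (fun q : LN.AttackState U × LN.AttackState C =>
      join W q.1 q.2) := by
    constructor
    · rintro ⟨x, y⟩ ⟨x', y'⟩ e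
      have e : join W x y = join W x' y' := e
      congr 1
      · funext m; rw [← h.join_left (x := x) (y := y), e, h.join_left]
      · funext m; rw [← h.join_right (x := x) (y := y), e, h.join_right]
    · intro z
      refine ⟨(fun m => z (incl h.left_subset m), fun m => z (incl h.right_subset m)), ?_⟩
      exact h.join_ext (fun m => h.join_left m) (fun m => h.join_right m)
  rw [← hbij.sum_comp (fun z => LN.initialBelief W z * f z), Fintype.sum_prod_type]
  simp only [h.initialBelief_join, Finset.mul_sum, mul_assoc]

/-! ### The value of a leaf component as a pivoting reward -/

namespace IsLeaf

variable {x : LN.AttackState U} {pr : V → ℝ} {v : ℝ}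

/-- Compare sums weighted by the initial belief in the states that have positive probability. -/
lemma sum_initialBelief_le {f f' : LN.AttackState C → ℝ}
    (hf : ∀ y, LN.initialBelief C y ≠ 0 → f y ≤ f' y) :
    ∑ y, LN.initialBelief C y * f y ≤ ∑ y, LN.initialBelief C y * f' y := by
  refine Finset.sum_le_sum fun y _ => ?_
  by_cases hy : LN.initialBelief C y = 0
  · simp [hy]
  · exact mul_le_mul_of_nonneg_left (hf y hy) (initialBelief_nonneg y)

lemma sum_initialBelief_const_add (r : ℝ) (f : LN.AttackState C → ℝ) :
    ∑ y, LN.initialBelief C y * (r + f y) = r + ∑ y, LN.initialBelief C y * f y := by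
  simp only [mul_add, Finset.sum_add_distrib, ← Finset.sum_mul, sum_initialBelief, one_mul]

/-- Until `p` is controlled, `C` is in its initial state, so the grafted plan `TC` gains on average at
least the pivoting reward `v` of `p`, up to `δ`. -/
lemma gain_sub_le_sum_graft (h : LN.IsLeaf W U C p) {TC : LN.Plan C} {δ : ℝ} (hδ : 0 ≤ δ)
    (hTC : v - δ ≤ LN.expGain LN.cleanArc p C pr TC) (T : LN.Plan U)
    (hs : ∀ y : LN.AttackState C, LN.initialBelief C y ≠ 0 → LN.Spread W (join W x y))
    (hp : ¬ LN.Controlled LN.root U x p) :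
    LN.gain LN.arc LN.root U (Function.update pr p (pr p + v)) T x - δ ≤
      ∑ y, LN.initialBelief C y * LN.gain LN.arc LN.root W pr
        (graft h.left_subset h.right_subset p TC T) (join W x y) := by
  induction T generalizing x with
  | halt => simpa [graft] using hδ
  | act q k ih =>
    obtain ⟨m, a⟩ := q
    have hs' := h.spread_nextState_left hs m a
    rw [gain_act, stepReward_update]
    by_cases hc : LN.response LN.arc LN.root U x m a = .succeeded ∧ LN.subnet m.1 = p
    · -- `p` has just come under control: `TC` meets the initial belief on `C`
      have hp' : LN.Controlled LN.root U (LN.nextState LN.arc LN.root U x m a) p :=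
        LN.controlled_nextState_iff.2 (Or.inr ⟨hc.2.symm, hc.1⟩)
      rw [if_pos ⟨hc.1, hc.2, hp⟩]
      refine le_trans ?_ (sum_initialBelief_le
        (f := fun y => (LN.stepReward LN.arc LN.root U pr x m a +
          LN.gain LN.arc LN.root U (Function.update pr p (pr p + v))
            (k (LN.response LN.arc LN.root U x m a)) (LN.nextState LN.arc LN.root U x m a)) +
          LN.gain LN.cleanArc p C pr TC y) fun y hy => le_of_eq ?_)
      · rw [sum_initialBelief_const_add]
        unfold expGain at hTC
        linarith
      · rw [graft, gain_act, h.response_left (hs y hy), h.nextState_left (hs y hy),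
          h.stepReward_left (hs y hy), if_pos hc, h.gain_seq_liftPlan _ _ (hs' y hy) hp']
        ring
    · have hp' : ¬ LN.Controlled LN.root U (LN.nextState LN.arc LN.root U x m a) p := fun h' =>
        (LN.controlled_nextState_iff.1 h').elim hp fun e => hc ⟨e.2, e.1.symm⟩
      rw [if_neg (fun h' => hc ⟨h'.1, h'.2.1⟩), add_zero, add_sub_assoc]
      refine le_trans (add_le_add_right (ih _ hs' hp') _) ?_
      rw [← sum_initialBelief_const_add]
      refine sum_initialBelief_le fun y hy => le_of_eq ?_
      rw [graft, gain_act, h.response_left (hs y hy), h.nextState_left (hs y hy),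
          h.stepReward_left (hs y hy), if_neg hc]

/-- As long as `p` is not under control, actions against `C` bring nothing and reveal nothing; when
`p` comes under control, the machines of `C` are still in their initial, independent
configurations, so that the rest of the plan gains at most `v` from them. -/
lemma sum_gain_le_sum_leftPart (h : LN.IsLeaf W U C p)
    (hv : ∀ TC, LN.expGain LN.cleanArc p C pr TC ≤ v) (T : LN.Plan W) {g : Prop} (hg : ¬ g)
    (hs : ∀ y : LN.AttackState C, LN.initialBelief C y ≠ 0 → LN.Spread W (join W x y))
    (hp : ¬ LN.Controlled LN.root U x p) :
    ∑ y, LN.initialBelief C y * LN.gain LN.arc LN.root W pr T (join W x y) ≤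
      ∑ y, LN.initialBelief C y * LN.gain LN.arc LN.root U (Function.update pr p (pr p + v))
        (leftPart U C p T g y) x := by
  induction T generalizing x g with
  | halt => simp [leftPart]
  | act q k ih =>
    obtain ⟨m, a⟩ := q
    rcases h.exists_incl m with ⟨m, rfl⟩ | ⟨m, rfl⟩
    · have hs' := h.spread_nextState_left hs m a
      have hW : ∀ y, LN.initialBelief C y ≠ 0 →
          LN.gain LN.arc LN.root W pr (.act (incl h.left_subset m, a) k) (join W x y) =
            LN.stepReward LN.arc LN.root U pr x m a + LN.gain LN.arc LN.root W pr
              (k (LN.response LN.arc LN.root U x m a))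
              (join W (LN.nextState LN.arc LN.root U x m a) y) := fun y hy => by
        rw [gain_act, h.response_left (hs y hy), h.nextState_left (hs y hy),
          h.stepReward_left (hs y hy)]
      refine (sum_initialBelief_le fun y hy => (hW y hy).le).trans ?_
      simp only [h.leftPart_incl_left, gain_act, stepReward_update]
      rw [sum_initialBelief_const_add, sum_initialBelief_const_add]
      by_cases hc : LN.response LN.arc LN.root U x m a = .succeeded ∧ LN.subnet m.1 = p
      · have hp' : LN.Controlled LN.root U (LN.nextState LN.arc LN.root U x m a) p :=
          LN.controlled_nextState_iff.2 (Or.inr ⟨hc.2.symm, hc.1⟩)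
        rw [if_pos ⟨hc.1, hc.2, hp⟩, add_assoc]
        refine add_le_add_right ?_ _
        refine (sum_initialBelief_le fun y hy =>
          (h.gain_eq_add (v := v) _ (Or.inr hc : g ∨ _) (hs' y hy) hp').le).trans ?_
        simp only [mul_add, Finset.sum_add_distrib]
        rw [add_comm]
        exact add_le_add_left (hv _) _
      · have hp' : ¬ LN.Controlled LN.root U (LN.nextState LN.arc LN.root U x m a) p :=
          fun h' => (LN.controlled_nextState_iff.1 h').elim hp fun e => hc ⟨e.2, e.1.symm⟩
        rw [if_neg (fun h' => hc ⟨h'.1, h'.2.1⟩), add_zero]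
        exact add_le_add_right (ih _ (not_or.2 ⟨hg, hc⟩) hs' hp') _
    · simp only [h.leftPart_incl_right, if_neg hg]
      refine le_trans (sum_initialBelief_le fun y hy => ?_) (ih .nothing hg hs hp)
      have hu := h.not_usable_right (hs y hy) hp m a
      rw [gain_act, LN.response_of_not_usable hu, LN.nextState_of_not_usable hu]
      linarith [LN.stepReward_nonpos_of_not_usable hu pr]

lemma exists_plan_ge (h : LN.IsLeaf W U C p) {TC : LN.Plan C} {δ : ℝ} (hδ : 0 ≤ δ)
    (hTC : v - δ ≤ LN.expGain LN.cleanArc p C pr TC) (T : LN.Plan U) :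
    ∃ T' : LN.Plan W, (if p = LN.root then v else 0) +
      LN.expGain LN.arc LN.root U (Function.update pr p (pr p + v)) T - δ ≤
        LN.expGain LN.arc LN.root W pr T' := by
  by_cases hp : p = LN.root
  · refine ⟨(liftPlan h.right_subset TC).seq (liftPlan h.left_subset T), ?_⟩
    rw [if_pos hp, expGain, expGain, h.sum_join]
    calc _ ≤ LN.expGain LN.cleanArc p C pr TC + ∑ x, LN.initialBelief U x *
          LN.gain LN.arc LN.root U (Function.update pr p (pr p + v)) T x := by linarith
      _ ≤ _ := by
        rw [← sum_initialBelief_const_add]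
        refine sum_initialBelief_le fun x hx => ?_
        rw [expGain, add_comm, ← sum_initialBelief_const_add]
        refine sum_initialBelief_le fun y hy => ?_
        rw [add_comm, h.gain_seq_liftPlan _ _ (h.spread_join hx y hy) (Or.inl hp)]
  · refine ⟨graft h.left_subset h.right_subset p TC T, ?_⟩
    rw [if_neg hp, zero_add, expGain, expGain, h.sum_join, sub_eq_neg_add,
      ← sum_initialBelief_const_add]
    refine sum_initialBelief_le fun x hx => ?_
    rw [← sub_eq_neg_add]
    exact h.gain_sub_le_sum_graft hδ hTC T (h.spread_join hx)
      (not_controlled_of_initialBelief_ne_zero hx hp)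

lemma exists_plan_le (h : LN.IsLeaf W U C p)
    (hv : ∀ TC, LN.expGain LN.cleanArc p C pr TC ≤ v) (T : LN.Plan W) :
    ∃ T' : LN.Plan U, LN.expGain LN.arc LN.root W pr T ≤ (if p = LN.root then v else 0) +
      LN.expGain LN.arc LN.root U (Function.update pr p (pr p + v)) T' := by
  -- it suffices to find a plan for each state of `C`: the best of them is at least their average
  have average : ∀ f : LN.AttackState C → LN.Plan U, ∃ T', ∑ x, LN.initialBelief U x *
      ∑ y, LN.initialBelief C y *
        LN.gain LN.arc LN.root U (Function.update pr p (pr p + v)) (f y) x ≤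
      LN.expGain LN.arc LN.root U (Function.update pr p (pr p + v)) T' := by
    intro f
    have hne : Nonempty (LN.AttackState C) := by
      by_contra hne
      rw [not_nonempty_iff] at hne
      have := LN.sum_initialBelief C
      simp at this
    obtain ⟨y₀, hy₀⟩ := Finite.exists_max fun y =>
      LN.expGain LN.arc LN.root U (Function.update pr p (pr p + v)) (f y)
    refine ⟨f y₀, ?_⟩
    calc _ = ∑ y, LN.initialBelief C y *
          LN.expGain LN.arc LN.root U (Function.update pr p (pr p + v)) (f y) := by
          simp only [expGain, Finset.mul_sum]
          rw [Finset.sum_comm]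
          refine Finset.sum_congr rfl fun y _ => Finset.sum_congr rfl fun x _ => by ring
      _ ≤ ∑ y, LN.initialBelief C y *
          LN.expGain LN.arc LN.root U (Function.update pr p (pr p + v)) (f y₀) :=
          sum_initialBelief_le fun y _ => hy₀ y
      _ = _ := by rw [← Finset.sum_mul, sum_initialBelief, one_mul]
  by_cases hp : p = LN.root
  · obtain ⟨T', hT'⟩ := average fun y => leftPart U C p T True y
    refine ⟨T', le_trans ?_ (add_le_add_right hT' _)⟩
    rw [if_pos hp, expGain, h.sum_join, ← sum_initialBelief_const_add]
    refine sum_initialBelief_le fun x hx => ?_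
    refine (sum_initialBelief_le fun y hy =>
      (h.gain_eq_add (v := v) T trivial (h.spread_join hx y hy) (Or.inl hp)).le).trans ?_
    simp only [mul_add, Finset.sum_add_distrib]
    rw [add_comm]
    exact add_le_add_left (hv _) _
  · obtain ⟨T', hT'⟩ := average fun y => leftPart U C p T False y
    refine ⟨T', le_trans ?_ (add_le_add_right hT' _)⟩
    rw [if_neg hp, zero_add, expGain, h.sum_join]
    exact sum_initialBelief_le fun x hx => h.sum_gain_le_sum_leftPart hv T not_false
      (h.spread_join hx) (not_controlled_of_initialBelief_ne_zero hx hp)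

end IsLeaf

end Belief

lemma coe_update_root (LN : LogicalNetwork V M Config Act Obs Port) (pr : V → ℝ) (p : V) (v : ℝ) :
    ((Function.update pr p (pr p + v) LN.root : ℝ) : EReal) =
      (pr LN.root : EReal) + ((if p = LN.root then v else 0 : ℝ) : EReal) := by
  rw [← EReal.coe_add]
  by_cases hp : p = LN.root
  · subst hp; simp
  · simp [Function.update_of_ne (Ne.symm hp), hp]

variable [Fintype M] [Fintype Config] {W U C : Set V} {p : V}

/-- The optimal value of attacking `U` from `*`, together with the pivoting reward of `*`. -/
def rootedValue (LN : LogicalNetwork V M Config Act Obs Port) (U : Set V) (pr : V → ℝ) : EReal :=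
  (pr LN.root : EReal) + (LN.attack LN.arc LN.root U pr).optValue

lemma IsLeaf.rootedValue_le (h : LN.IsLeaf W U C p) {pr : V → ℝ} {v : ℝ}
    (hv : (LN.attack LN.cleanArc p C pr).optValue ≤ v) :
    LN.rootedValue W pr ≤ LN.rootedValue U (Function.update pr p (pr p + v)) := by
  rw [rootedValue, rootedValue, LN.coe_update_root, add_assoc]
  refine add_le_add_right ?_ _
  rw [optValue_attack] at hv
  rw [optValue_attack, optValue_attack]
  refine iSup_le fun T => ?_
  obtain ⟨T', hT'⟩ := h.exists_plan_le
    (fun TC => EReal.coe_le_coe_iff.1 ((le_iSup _ TC).trans hv)) T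
  refine (EReal.coe_le_coe_iff.2 hT').trans ?_
  rw [EReal.coe_add]
  exact add_le_add_right (le_iSup (fun T : LN.Plan U => ((LN.expGain LN.arc LN.root U
    (Function.update pr p (pr p + v)) T : ℝ) : EReal)) T') _

lemma IsLeaf.le_rootedValue (h : LN.IsLeaf W U C p) {pr : V → ℝ} {v : ℝ}
    (hv : v ≤ (LN.attack LN.cleanArc p C pr).optValue) :
    LN.rootedValue U (Function.update pr p (pr p + v)) ≤ LN.rootedValue W pr := by
  rw [rootedValue, rootedValue, LN.coe_update_root, add_assoc]
  refine add_le_add_right ?_ _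
  rw [optValue_attack] at hv
  rw [optValue_attack, optValue_attack]
  generalize hc : (if p = LN.root then v else 0 : ℝ) = c
  -- bring the constant to the other side, where it does not stand before a supremum
  suffices hsup : (⨆ T : LN.Plan U, ((LN.expGain LN.arc LN.root U
      (Function.update pr p (pr p + v)) T : ℝ) : EReal)) ≤ ((-c : ℝ) : EReal) +
      ⨆ T : LN.Plan W, ((LN.expGain LN.arc LN.root W pr T : ℝ) : EReal) by
    refine (add_le_add_right hsup _).trans ?_
    rw [← add_assoc, ← EReal.coe_add, add_neg_cancel, EReal.coe_zero, zero_add]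
  refine iSup_le fun T => ?_
  generalize he : LN.expGain LN.arc LN.root U (Function.update pr p (pr p + v)) T = e
  suffices hle : ((c + e : ℝ) : EReal) ≤
      ⨆ T : LN.Plan W, ((LN.expGain LN.arc LN.root W pr T : ℝ) : EReal) by
    refine le_trans ?_ (add_le_add_right hle _)
    rw [← EReal.coe_add, neg_add_cancel_left]
  refine EReal.ge_of_forall_gt_iff_ge.1 fun z hz => ?_
  have hz : 0 < c + e - z := sub_pos.2 (EReal.coe_lt_coe_iff.1 hz)
  have hlt : ((v - (c + e - z) : ℝ) : EReal) <
      ⨆ TC : LN.Plan C, ((LN.expGain LN.cleanArc p C pr TC : ℝ) : EReal) :=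
    lt_of_lt_of_le (EReal.coe_lt_coe_iff.2 (by linarith)) hv
  obtain ⟨TC, hTC⟩ := lt_iSup_iff.1 hlt
  obtain ⟨T', hT'⟩ := h.exists_plan_ge hz.le (EReal.coe_lt_coe_iff.1 hTC).le T
  refine le_trans (EReal.coe_le_coe_iff.2 ?_)
    (le_iSup (fun T : LN.Plan W => ((LN.expGain LN.arc LN.root W pr T : ℝ) : EReal)) T')
  rw [hc, he] at hT'
  linarith

end LogicalNetwork

namespace LogicalNetwork

variable {V M Config Act Obs Port : Type*} {LN : LogicalNetwork V M Config Act Obs Port}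

/-! ### The loop of Level 1 -/

/-- The subnetworks that belong to one of the listed components. -/
def coveredBy (l : List (Component V)) : Set V := {N | ∃ C ∈ l, N ∈ C.nodes}

/-- The other subnetworks, except `*`. -/
def uncovered (LN : LogicalNetwork V M Config Act Obs Port) (l : List (Component V)) : Set V :=
  {N | N ∉ coveredBy l ∧ N ≠ LN.root}

lemma isLeaf_coveredBy_cons [Finite V] {C : Component V} {l : List (Component V)}
    (hC : LN.IsComponent C) (hl : ∀ C' ∈ l, LN.IsComponent C') (hCl : C ∉ l)
    (hpar : ∀ C' ∈ l, C'.parent ∉ C.nodes) :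
    LN.IsLeaf (coveredBy (C :: l)) (coveredBy l) C.nodes C.parent where
  left_subset := fun _ ⟨C', h, hN⟩ => ⟨C', List.mem_cons_of_mem _ h, hN⟩
  right_subset := fun _ hN => ⟨C, by simp, hN⟩
  cover := by
    rintro m ⟨C', h, hN⟩
    rcases List.mem_cons.1 h with rfl | h
    · exact Or.inr hN
    · exact Or.inl ⟨C', h, hN⟩
  notMem_right := by
    rintro N ⟨C', h, hN⟩ hN'
    exact hCl (hC.eq_of_mem LN (hl C' h) hN' hN ▸ h)
  root_notMem := hC.root_notMem
  gate_notMem := hC.parent_notMem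
  no_return := by
    rintro N N' harc hN ⟨C', h, hN'⟩
    obtain ⟨C'', hC'', hmem, htail⟩ := LN.exists_isComponent_of_cleanArc harc
    obtain rfl := hC''.eq_of_mem LN (hl C' h) hmem hN'
    rcases htail with htail | rfl
    · exact hCl (hC.eq_of_mem LN hC'' hN htail ▸ h)
    · exact hpar _ h hN
  entry := by
    intro N N' harc hN'
    obtain ⟨C', hC', hmem, htail⟩ := LN.exists_isComponent_of_cleanArc harc
    obtain rfl := hC.eq_of_mem LN hC' hN' hmem
    exact htail
  gate := by
    intro hp N hN hpath
    obtain ⟨w, hw⟩ := LN.exists_walk_of_reflTransGen hpath hp.symm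
    exact hw (hC.mem_support LN hN w)

/-- The subnetworks outside all components cannot be reached; they form a worthless leaf. -/
lemma isLeaf_univ [Finite V] {l : List (Component V)} (hl : ∀ C, C ∈ l ↔ LN.IsComponent C) :
    LN.IsLeaf Set.univ (coveredBy l) (LN.uncovered l) LN.root where
  left_subset := Set.subset_univ _
  right_subset := Set.subset_univ _
  cover := fun m _ => (em _).imp_right fun h => ⟨h, LN.subnet_ne_root m⟩
  notMem_right := fun _ hN h => h.1 hN
  root_notMem := fun h => h.2 rfl
  gate_notMem := fun h => h.2 rfl
  no_return := by
    intro N N' harc hN _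
    obtain ⟨N₀, h₀⟩ := LN.exists_cleanArc_of_cleanArc harc hN.2
    obtain ⟨C, hC, hmem, -⟩ := LN.exists_isComponent_of_cleanArc h₀
    exact hN.1 ⟨C, (hl C).2 hC, hmem⟩
  entry := by
    intro N N' harc hN'
    obtain ⟨C, hC, hmem, -⟩ := LN.exists_isComponent_of_cleanArc harc
    exact absurd ⟨C, (hl C).2 hC, hmem⟩ hN'.1
  gate := fun h => absurd rfl h

variable [Fintype M] [Fintype Config]

/-- Without usable actions, nothing can be gained. -/
lemma optValue_eq_zero_of_not_usable {E : V → V → Prop} {src : V} {C : Set V} {pr : V → ℝ}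
    (h : ∀ s : LN.AttackState C, (∀ m, s m ≠ none) → ∀ m a, ¬ LN.Usable E src C s m a) :
    (LN.attack E src C pr).optValue = 0 := by
  rw [optValue_attack]
  apply le_antisymm
  · refine iSup_le fun T => ?_
    rw [← EReal.coe_zero, EReal.coe_le_coe_iff]
    refine Finset.sum_nonpos fun s _ => ?_
    by_cases hs : LN.initialBelief C s = 0
    · simp [hs]
    refine mul_nonpos_of_nonneg_of_nonpos (initialBelief_nonneg s) ?_
    have hs := ne_none_of_initialBelief_ne_zero hs
    induction T with
    | halt => exact le_rfl
    | act q k ih =>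
      obtain ⟨m, a⟩ := q
      rw [gain_act, LN.nextState_of_not_usable (h s hs m a)]
      exact add_nonpos (LN.stepReward_nonpos_of_not_usable (h s hs m a) pr) (ih _)
  · refine le_trans (le_of_eq ?_) (le_iSup _ .halt)
    simp [expGain]

lemma rootedValue_coveredBy_nil (pr : V → ℝ) :
    LN.rootedValue (coveredBy []) pr = (pr LN.root : EReal) := by
  rw [rootedValue, optValue_eq_zero_of_not_usable, add_zero]
  rintro s - ⟨m, C, hC, -⟩
  exact absurd hC List.not_mem_nil

lemma rootedValue_coveredBy_eq_optimalValue [Finite V] {l : List (Component V)}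
    (hl : ∀ C, C ∈ l ↔ LN.IsComponent C) :
    LN.rootedValue (coveredBy l) 0 = LN.optimalValue := by
  have hleaf := LN.isLeaf_univ hl
  have hzero : (LN.attack LN.cleanArc LN.root (LN.uncovered l) 0).optValue = ((0 : ℝ) : EReal) := by
    refine (optValue_eq_zero_of_not_usable ?_).trans EReal.coe_zero.symm
    rintro s hs m a (hc | ⟨N, -, harc, -⟩)
    · rcases hc with hc | ⟨m', -, hm'⟩
      · exact LN.subnet_ne_root _ hc
      · exact hs m' hm'
    · obtain ⟨C, hC, hmem, -⟩ := LN.exists_isComponent_of_cleanArc harc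
      exact m.2.1 ⟨C, (hl C).2 hC, hmem⟩
  have h := le_antisymm (hleaf.rootedValue_le hzero.le) (hleaf.le_rootedValue hzero.ge)
  rw [add_zero, Function.update_eq_self] at h
  rw [← h, rootedValue, optimalValue, Pi.zero_apply, EReal.coe_zero, zero_add]
  -- the two sides enumerate the states by different instances
  congr!

/-- Each pass of the loop moves the value of a leaf into the pivoting reward of its parent, until
only the pivoting reward of `*` is left. -/
lemma level1Loop_spec [Finite V] (L2 : Component V → (V → ℝ) → ℝ) {l : List (Component V)}
    (hl : ∀ C ∈ l, LN.IsComponent C) (hnd : l.Nodup)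
    (hpar : l.Pairwise fun C C' => C'.parent ∉ C.nodes) (pr : V → ℝ) :
    ((∀ call ∈ loopCalls L2 l pr, (L2 call.1 call.2 : EReal) = LN.componentValue call.1 call.2) →
      (level1Loop L2 l pr LN.root : EReal) = LN.rootedValue (coveredBy l) pr) ∧
    ((∀ call ∈ loopCalls L2 l pr, (L2 call.1 call.2 : EReal) ≤ LN.componentValue call.1 call.2) →
      (level1Loop L2 l pr LN.root : EReal) ≤ LN.rootedValue (coveredBy l) pr) := by
  induction l generalizing pr with
  | nil =>
    rw [rootedValue_coveredBy_nil]
    exact ⟨fun _ => rfl, fun _ => le_rfl⟩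
  | cons C l ih =>
    rw [List.nodup_cons] at hnd
    rw [List.pairwise_cons] at hpar
    have hl' : ∀ C' ∈ l, LN.IsComponent C' := fun C' h => hl C' (List.mem_cons_of_mem _ h)
    have hleaf := isLeaf_coveredBy_cons (hl C (by simp)) hl' hnd.1 hpar.1
    obtain ⟨ih₁, ih₂⟩ := ih hl' hnd.2 hpar.2
      (Function.update pr C.parent (pr C.parent + L2 C pr))
    simp only [loopCalls, level1Loop, List.forall_mem_cons]
    refine ⟨fun ⟨hC, h⟩ => (ih₁ h).trans ?_, fun ⟨hC, h⟩ => (ih₂ h).trans ?_⟩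
    · exact le_antisymm (hleaf.le_rootedValue hC.le) (hleaf.rootedValue_le hC.ge)
    · exact hleaf.le_rootedValue hC

end LogicalNetwork

end

theorem proposition1 {V M Config Act Obs Port : Type*} [Finite V] [Fintype M] [Fintype Config]
    [Finite Act] [Finite Obs] (LN : LogicalNetwork V M Config Act Obs Port)
    (order : List (LogicalNetwork.Component V)) (horder : LN.IsTopologicalOrder order)
    (L2 : LogicalNetwork.Component V → (V → ℝ) → ℝ) :
    ((∀ call ∈ LogicalNetwork.level2Calls L2 order,
        (L2 call.1 call.2 : EReal) = LN.componentValue call.1 call.2) →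
      (LN.level1 L2 order : EReal) = LN.optimalValue) ∧
    ((∀ call ∈ LogicalNetwork.level2Calls L2 order,
        (L2 call.1 call.2 : EReal) ≤ LN.componentValue call.1 call.2) →
      (LN.level1 L2 order : EReal) ≤ LN.optimalValue) := by
  obtain ⟨hnd, hmem, hpar⟩ := horder
  have hmem' : ∀ C, C ∈ order.reverse ↔ LN.IsComponent C := fun C => by
    rw [List.mem_reverse, hmem]
  rw [← LogicalNetwork.rootedValue_coveredBy_eq_optimalValue hmem']
  exact LogicalNetwork.level1Loop_spec L2 (fun C h => (hmem' C).1 h) (List.nodup_reverse.2 hnd)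
    (List.pairwise_reverse.2 hpar) 0
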